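/- Let $M$ be a compact connected oriented smooth $4$-manifold without boundary, let $\alpha$ be the volume form of the sphere $S^4$, normalized to total volume $1$, and write $\phi^{\#}(\alpha)$ for the pull-back of $\alpha$ by a smooth map $\phi:M\to S^4$. Let $\phi:M\to S^4$ be a smooth map such that $\phi^{\#}(\alpha)(x)\ge 0$ for all $x\in M$ (with respect to the orientation of $M$), and assume that $\phi^{\#}(\alpha)$ is not identically zero. Let $R=\{x\in M\mid \phi^{\#}(\alpha)(x)=0\}$. Then there exists a smooth map $\phi':M\to S^4$ such that $\phi^{\#}(\alpha)+\phi'^{\#}(\alpha)$ does not vanish at any point of $M$ if and only if there exists a smooth immersion $f:V\to\mathbb{R}^4$ of some open neighborhood $V$ of $R$ in $M$. Moreover, if such an immersion exists, then $\phi'$ with this property can be chosen to be of degree $0$. -/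

import Mathlib

open Set Filter
open scoped Topology Manifold ContDiff EuclideanSpace

noncomputable section

/-- The model space `ℝ⁴`. -/
abbrev R4 : Type := EuclideanSpace ℝ (Fin 4)

/-- The unit sphere `S⁴` in `ℝ⁵`, with Mathlib's smooth structure. -/
abbrev S4 : Type := Metric.sphere (0 : EuclideanSpace ℝ (Fin (4 + 1))) 1

/-- The tangent space `T_x M` of a `4`-manifold. -/
abbrev T4 {M : Type*} [TopologicalSpace M] [ChartedSpace R4 M] (x : M) : Type :=
  TangentSpace (𝓡 4) x

/-- Alternating `4`-forms on the tangent space `T_x M`. -/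
abbrev TopForm4 {M : Type*} [TopologicalSpace M] [ChartedSpace R4 M] (x : M) : Type :=
  T4 x [⋀^Fin 4]→ₗ[ℝ] ℝ

/-- An orientation of a smooth `4`-manifold `M`: an orientation of every tangent space which is
locally constant when the tangent spaces near a point `x₀` are identified with `ℝ⁴` by the
differential of the chart at `x₀`. -/
structure Orientation4 (M : Type*) [TopologicalSpace M] [ChartedSpace R4 M]
    [IsManifold (𝓡 4) ∞ M] where
  orient : ∀ x : M, Orientation ℝ (T4 x) (Fin 4)
  locally_constant : ∀ x₀ : M, ∃ o₀ : Orientation ℝ R4 (Fin 4), ∀ᶠ x in 𝓝 x₀,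
    ∀ hx : x ∈ (trivializationAt R4 (TangentSpace (𝓡 4) : M → Type) x₀).baseSet,
      Orientation.map (Fin 4)
        ((trivializationAt R4 (TangentSpace (𝓡 4) : M → Type) x₀).continuousLinearEquivAt
          ℝ x hx).toLinearEquiv (orient x) = o₀

/-- The volume form `α` of `S⁴`, normalized to total volume `1` (the Euclidean volume of the unit
sphere is `8π²/3`): up to this factor `α_y(v₁, …, v₄) = det (y, v₁, …, v₄)`, where tangent vectors
are pushed into `ℝ⁵` by the differential of the inclusion. -/
def sphereVolumeForm (y : S4) : TopForm4 y :=
  (3 / (8 * Real.pi ^ 2) : ℝ) •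
    (((EuclideanSpace.basisFun (Fin (4 + 1)) ℝ).toBasis.det.curryLeft
        (y : EuclideanSpace ℝ (Fin (4 + 1)))).compLinearMap
      (mfderiv (𝓡 4) 𝓘(ℝ, EuclideanSpace ℝ (Fin (4 + 1)))
        (fun z : S4 => (z : EuclideanSpace ℝ (Fin (4 + 1)))) y).toLinearMap)

section

variable {M : Type*} [TopologicalSpace M] [ChartedSpace R4 M]

/-- The value at `x` of the pull-back `φ^#(α)` of the volume form of `S⁴`. -/
def pullbackVolume (φ : M → S4) (x : M) : TopForm4 x :=
  (sphereVolumeForm (φ x)).compLinearMap (mfderiv (𝓡 4) (𝓡 4) φ x).toLinearMap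

/-- The zero set of `φ^#(α)`. -/
def zeroLocus (φ : M → S4) : Set M := {x | pullbackVolume φ x = 0}

/-- `y` is a regular value of `φ`: the differential of `φ` is onto at every preimage of `y`. -/
def IsRegularValue4 (φ : M → S4) (y : S4) : Prop :=
  ∀ x : M, φ x = y → Function.Surjective (mfderiv (𝓡 4) (𝓡 4) φ x)

namespace Orientation4

variable [IsManifold (𝓡 4) ∞ M] (o : Orientation4 M)

/-- A `4`-form on `T_x M` is `≥ 0` if it is so on the positively oriented bases. -/
def Nonneg {x : M} (η : TopForm4 x) : Prop :=
  ∀ b : Module.Basis (Fin 4) ℝ (T4 x), b.orientation = o.orient x → 0 ≤ η b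

/-- A `4`-form on `T_x M` is `> 0` if it is so on the positively oriented bases. -/
def Pos {x : M} (η : TopForm4 x) : Prop :=
  ∀ b : Module.Basis (Fin 4) ℝ (T4 x), b.orientation = o.orient x → 0 < η b

open Classical in
/-- The sign of a `4`-form on the oriented space `T_x M`. -/
def sign {x : M} (η : TopForm4 x) : ℤ :=
  if o.Pos η then 1 else if o.Pos (-η) then -1 else 0

/-- `φ` has degree `d`: regular values exist, and for each regular value `y` the points of
`φ⁻¹(y)`, counted with the sign `±1` according to whether `φ` preserves or reverses the
orientation there, sum to `d`. (On a compact manifold these fibres are finite.) -/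
def HasDegree (φ : M → S4) (d : ℤ) : Prop :=
  (∃ y : S4, IsRegularValue4 φ y) ∧
    ∀ y : S4, IsRegularValue4 φ y → ∑ᶠ x ∈ φ ⁻¹' {y}, o.sign (pullbackVolume φ x) = d

end Orientation4

end

/-- Some open neighbourhood `V` of `R` in `M` admits a smooth immersion `V → ℝ⁴`. -/
def HasImmersedNeighborhood {M : Type*} [TopologicalSpace M] [ChartedSpace R4 M] (R : Set M) :
    Prop :=
  ∃ V : TopologicalSpace.Opens M, R ⊆ V ∧
    ∃ f : V → R4, Manifold.IsImmersion (𝓡 4) (𝓡 4) ∞ f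

end

noncomputable section

/-! ### Counting points in the fibres of a real function on a curve -/

section Counting

variable {X : Type*} [TopologicalSpace X]

/-! Write `R` for the zero set of the pull-back by `φ`.

From a map to an immersion: where `φ^#(α)` vanishes, `φ'^#(α)` does not, so `φ'` is a local
diffeomorphism near `R`. Stereographic projection from a point `pt` would turn it into an immersion
to `ℝ⁴`, were it not for the points of `R` over `pt`. In a compact neighbourhood of `R` there are
only finitely many points over `pt`. Since `M` is connected and `R ≠ M`, a self-immersion `g` of `M`
that is the identity away from `R` can be chosen so that `g(R)` misses them
(`exists_isPush_preimage_disjoint`). Then `φ' ∘ g` followed by the projection is an immersion near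
`R` (`hasImmersedNeighborhood_of_map`).

From an immersion to a map: composing with a linear map of negative determinant where necessary, `f`
may be taken orientation preserving. Multiply it by a cutoff `χ` equal to `1` near `R` and by a
small `ε`, and apply the central projection of `ℝ⁴` onto an open hemisphere. Near `R` a positive
form is added to a nonnegative one. On the compact remainder `φ^#(α)` is already positive, and a
small enough perturbation keeps it so (`exists_uniform_pos`, `exists_complementary_map`).

The resulting map is not onto, but degree `0` is required at every regular value, so signed fibres
must be counted (`hasDegree_zero_of_smul`). The points with `χ f = z` lie on the curve where `f = s
z` with `s > 0`, and there they are the solutions of `s χ = 1`. The sign at such a point says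
whether `s χ` crosses the level `1` upwards or downwards as `s` grows. The part of the curve with `s
χ ≥ 1` is compact, so the entries into it and the exits from it balance (`finsum_crossing_eq_zero`).
-/

theorem eventually_fiber_subset {s : X → ℝ} (hs : Continuous s) {A U : Set X} (hA : IsCompact A)
    (hU : IsOpen U) {t₀ : ℝ} (h : ∀ x ∈ A, s x = t₀ → x ∈ U) :
    ∀ᶠ t in 𝓝 t₀, ∀ x ∈ A, s x = t → x ∈ U := by
  have hc : IsClosed (s '' (A \ U)) := ((hA.diff hU).image hs).isClosed
  have : t₀ ∉ s '' (A \ U) := by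
    rintro ⟨x, hx, rfl⟩
    exact hx.2 (h x hx.1 rfl)
  filter_upwards [hc.isOpen_compl.mem_nhds this] with t ht x hx hxt
  by_contra hxU
  exact ht ⟨x, ⟨hx, hxU⟩, hxt⟩

/-- `c` is a local section of `s` through `p`, parametrizing a neighbourhood of `p`. -/
def IsLocalSection (s : X → ℝ) (p : X) (c : ℝ → X) : Prop :=
  ContinuousAt c (s p) ∧ c (s p) = p ∧ (∀ᶠ t in 𝓝 (s p), s (c t) = t) ∧ ∀ᶠ x in 𝓝 p, c (s x) = x

theorem IsLocalSection.eventually_injective {s : X → ℝ} {p : X} {c : ℝ → X}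
    (h : IsLocalSection s p c) : ∀ᶠ x in 𝓝 p, s x = s p → x = p := by
  filter_upwards [h.2.2.2] with x hx hxp
  rw [← hx, hxp, h.2.1]

theorem IsLocalSection.neg {s : X → ℝ} {p : X} {c : ℝ → X} (h : IsLocalSection s p c) :
    IsLocalSection (fun x => -s x) p (fun t => c (-t)) := by
  obtain ⟨h1, h2, h3, h4⟩ := h
  have hn : Tendsto (fun t : ℝ => -t) (𝓝 (-s p)) (𝓝 (s p)) := by
    simpa using (continuous_neg.tendsto (-s p))
  refine ⟨?_, by simpa using h2, ?_, by simpa using h4⟩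
  · refine ContinuousAt.comp (f := fun t : ℝ => -t) (x := -s p) ?_ continuous_neg.continuousAt
    simpa using h1
  · filter_upwards [hn.eventually h3] with t ht
    linarith

theorem finite_of_forall_eventually_eq {A : Set X} (hA : IsCompact A) {P : X → Prop}
    (hP : ∀ p ∈ A, ∀ᶠ x in 𝓝 p, P x → x = p) : {x ∈ A | P x}.Finite := by
  choose! U hU using fun p hp => (hP p hp).exists_mem
  obtain ⟨t, ht, hAt⟩ := hA.elim_nhds_subcover U fun p hp => (hU p hp).1
  refine t.finite_toSet.subset fun x hx => ?_
  obtain ⟨p, hp, hxp⟩ := mem_iUnion₂.1 (hAt hx.1)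
  rw [(hU p (ht p hp)).2 x hxp hx.2]
  exact hp

variable [T2Space X]

/-- Each point of the fibre over `t₀` with `h ≥ 1` continues uniquely along its local section.
Points with `h > 1` persist, while those on `h = 1` enter or leave the region according to `sg`.
Compactness excludes any further points over nearby `t`, and the separating sets `W` keep the
continuations distinct. -/
theorem eventually_ncard_fiber {s h : X → ℝ} (hs : Continuous s) (hh : Continuous h)
    (hA : IsCompact {x | 1 ≤ h x})
    (hsec : ∀ p, 1 ≤ h p → ∃ c, IsLocalSection s p c) (sg : X → ℤ)
    (hsg : ∀ p, h p = 1 → (sg p = 1 ∧ ∀ᶠ x in 𝓝 p, s p < s x → 1 < h x) ∨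
      (sg p = -1 ∧ ∀ᶠ x in 𝓝 p, s p < s x → h x < 1)) (t₀ : ℝ) :
    ∀ᶠ t in 𝓝[>] t₀, {x | s x = t ∧ 1 < h x}.ncard =
      {x | s x = t₀ ∧ 1 < h x}.ncard + {x | s x = t₀ ∧ h x = 1 ∧ sg x = 1}.ncard := by
  classical
  choose! c hc using hsec
  have hDfin : {x ∈ {x | 1 ≤ h x} | s x = t₀}.Finite := by
    refine finite_of_forall_eventually_eq hA fun p hp => ?_
    by_cases hpt : s p = t₀
    · subst hpt; exact (hc p hp).eventually_injective
    · filter_upwards [hs.continuousAt.eventually_ne hpt] with x hx hx' using absurd hx' hx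
  set D := {x ∈ {x | 1 ≤ h x} | s x = t₀} with hD
  set P := {x | s x = t₀ ∧ 1 < h x} ∪ {x | s x = t₀ ∧ h x = 1 ∧ sg x = 1} with hPdef
  have hPD : P ⊆ D := by
    rintro x (⟨h1, h2⟩ | ⟨h1, h2, -⟩)
    · exact ⟨h2.le, h1⟩
    · exact ⟨h2.ge, h1⟩
  have hPfin : P.Finite := hDfin.subset hPD
  have hPcard : P.ncard = {x | s x = t₀ ∧ 1 < h x}.ncard +
      {x | s x = t₀ ∧ h x = 1 ∧ sg x = 1}.ncard := by
    refine ncard_union_eq ?_ (hPfin.subset subset_union_left) (hPfin.subset subset_union_right)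
    rw [Set.disjoint_left]
    rintro x ⟨-, h1⟩ ⟨-, h2, -⟩
    exact absurd h2 h1.ne'
  obtain ⟨W, hW, hWdisj⟩ := hDfin.t2_separation
  have hgood : ∀ p ∈ D, ∀ᶠ x in 𝓝 p, x ∈ W p ∧ c p (s x) = x ∧
      (p ∈ P → t₀ < s x → 1 < h x) ∧ (p ∉ P → t₀ < s x → h x < 1) := by
    intro p hp
    have h1 := (hc p hp.1).2.2.2
    have h0 : ∀ᶠ x in 𝓝 p, x ∈ W p := (hW p).2.mem_nhds (hW p).1
    rcases lt_or_eq_of_le (show 1 ≤ h p from hp.1) with hlt | heq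
    · have hpP : p ∈ P := Or.inl ⟨hp.2, hlt⟩
      filter_upwards [h0, h1, hh.continuousAt.eventually_const_lt hlt] with x a b d
      exact ⟨a, b, fun _ _ => d, fun h => absurd hpP h⟩
    · rcases hsg p heq.symm with ⟨h2, h3⟩ | ⟨h2, h3⟩
      · have hpP : p ∈ P := Or.inr ⟨hp.2, heq.symm, h2⟩
        filter_upwards [h0, h1, h3] with x a b d
        exact ⟨a, b, fun _ => hp.2 ▸ d, fun h => absurd hpP h⟩
      · have hpP : p ∉ P := by
          rintro (⟨-, h⟩ | ⟨-, -, h⟩)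
          · exact absurd heq h.ne
          · rw [h2] at h; norm_num at h
        filter_upwards [h0, h1, h3] with x a b d
        exact ⟨a, b, fun h => absurd h hpP, fun _ => hp.2 ▸ d⟩
  have hcov := eventually_fiber_subset hs hA
    (U := ⋃ p ∈ D, interior {x | x ∈ W p ∧ c p (s x) = x ∧
      (p ∈ P → t₀ < s x → 1 < h x) ∧ (p ∉ P → t₀ < s x → h x < 1)})
    (isOpen_biUnion fun _ _ => isOpen_interior) (t₀ := t₀) (fun x hx hxt =>
      mem_biUnion (show x ∈ D from ⟨hx, hxt⟩) (mem_interior_iff_mem_nhds.2 (hgood x ⟨hx, hxt⟩)))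
  have hlift : ∀ᶠ t in 𝓝 t₀, ∀ p ∈ P, s (c p t) = t ∧ c p t ∈ W p ∧
      (t₀ < s (c p t) → 1 < h (c p t)) := by
    rw [eventually_all_finite hPfin]
    intro p hp
    have hpD := hPD hp
    obtain ⟨h1, h2, h3, -⟩ := hc p hpD.1
    rw [hpD.2] at h1 h2 h3
    have := h1.eventually (show ∀ᶠ x in 𝓝 (c p t₀), _ by rw [h2]; exact hgood p hpD)
    filter_upwards [h3, this] with t a b
    exact ⟨a, b.1, b.2.2.1 hp⟩
  rw [← hPcard]
  filter_upwards [nhdsWithin_le_nhds hcov, nhdsWithin_le_nhds hlift, self_mem_nhdsWithin]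
    with t h1 h2 (h3 : t₀ < t)
  have himg : {x | s x = t ∧ 1 < h x} = (fun p => c p t) '' P := by
    ext x
    constructor
    · rintro ⟨hx, hx1⟩
      obtain ⟨p, hp, hxp⟩ := mem_iUnion₂.1 (h1 x hx1.le hx)
      obtain ⟨-, b, -, d⟩ := interior_subset hxp
      have hpP : p ∈ P := by
        by_contra hpP
        exact absurd (d hpP (hx ▸ h3)) hx1.not_gt
      exact ⟨p, hpP, by rw [hx] at b; exact b⟩
    · rintro ⟨p, hp, rfl⟩
      obtain ⟨a, -, b⟩ := h2 p hp
      exact ⟨a, b (by rw [a]; exact h3)⟩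
  rw [himg]
  refine InjOn.ncard_image fun p hp q hq hpq => ?_
  by_contra hne
  refine (Set.disjoint_left.1 (hWdisj (hPD hp) (hPD hq) hne)) (h2 p hp).2.1 ?_
  have := (h2 q hq).2.1
  rwa [show c p t = c q t from hpq]

theorem finsum_crossing_eq_zero {s h : X → ℝ} (hs : Continuous s) (hh : Continuous h)
    (hA : IsCompact {x | 1 ≤ h x})
    (hsec : ∀ p, 1 ≤ h p → ∃ c, IsLocalSection s p c) (sg : X → ℤ)
    (hsg : ∀ p, h p = 1 →
      (sg p = 1 ∧ ∀ᶠ x in 𝓝 p, (s p < s x → 1 < h x) ∧ (s x < s p → h x < 1)) ∨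
      (sg p = -1 ∧ ∀ᶠ x in 𝓝 p, (s p < s x → h x < 1) ∧ (s x < s p → 1 < h x))) :
    ∑ᶠ x ∈ {x | h x = 1}, sg x = 0 := by
  classical
  have hBfin : {x | h x = 1}.Finite := by
    refine (finite_of_forall_eventually_eq hA (P := fun x => h x = 1) fun p hp => ?_).subset
      fun x hx => ⟨(show h x = 1 from hx).ge, hx⟩
    by_cases h1 : h p = 1
    · obtain ⟨c, hc⟩ := hsec p hp
      rcases hsg p h1 with ⟨-, h2⟩ | ⟨-, h2⟩ <;>
      · filter_upwards [h2, hc.eventually_injective] with x a b e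
        refine b (le_antisymm (le_of_not_gt fun h => ?_) (le_of_not_gt fun h => ?_))
        · exact absurd e (by first | exact (a.1 h).ne' | exact (a.1 h).ne)
        · exact absurd e (by first | exact (a.2 h).ne' | exact (a.2 h).ne)
    · filter_upwards [hh.continuousAt.eventually_ne h1] with x hx hx' using absurd hx' hx
  set B := hBfin.toFinset with hB
  have hright := fun t₀ => eventually_ncard_fiber hs hh hA hsec sg (fun p hp => by
    rcases hsg p hp with ⟨h1, h2⟩ | ⟨h1, h2⟩
    · exact Or.inl ⟨h1, h2.mono fun _ h => h.1⟩
    · exact Or.inr ⟨h1, h2.mono fun _ h => h.1⟩) t₀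
  -- Replacing `s` by `-s` exchanges entries and exits, so the left-hand count follows from the
  -- right-hand one with `-sg`.
  have hleft := fun t₀ => eventually_ncard_fiber (s := fun x => -s x) hs.neg hh hA
    (fun p hp => (hsec p hp).elim fun c hc => ⟨_, hc.neg⟩) (fun x => -sg x) (fun p hp => by
    rcases hsg p hp with ⟨h1, h2⟩ | ⟨h1, h2⟩
    · exact Or.inr ⟨by simp [h1], h2.mono fun _ h h' => h.2 (by linarith)⟩
    · exact Or.inl ⟨by simp [h1], h2.mono fun _ h h' => h.2 (by linarith)⟩) (-t₀)
  have hsg' : ∀ x ∈ B, sg x = 1 ∨ sg x = -1 := by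
    intro x hx
    rcases hsg x (by simpa [hB] using hx) with ⟨h1, -⟩ | ⟨h1, -⟩
    · exact Or.inl h1
    · exact Or.inr h1
  set N : ℝ → ℕ := fun t => {x | s x = t ∧ 1 < h x}.ncard with hN
  have hcard : ∀ (t : ℝ) (k : ℤ), {x | s x = t ∧ h x = 1 ∧ sg x = k}.ncard =
      (B.filter fun x => s x = t ∧ sg x = k).card := by
    intro t k
    rw [← ncard_coe_finset]
    congr 1
    ext x
    simp [hB]
    tauto
  have hR : ∀ t₀, ∀ᶠ t in 𝓝[>] t₀, N t = N t₀ + (B.filter fun x => s x = t₀ ∧ sg x = 1).card := by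
    intro t₀
    filter_upwards [hright t₀] with t ht
    rw [← hcard]; exact ht
  have hL : ∀ t₀, ∀ᶠ t in 𝓝[<] t₀,
      N t = N t₀ + (B.filter fun x => s x = t₀ ∧ sg x = -1).card := by
    intro t₀
    have h1 := hleft t₀
    have h2 : Tendsto (fun t : ℝ => -t) (𝓝[<] t₀) (𝓝[>] (-t₀)) := tendsto_neg_nhdsLT
    filter_upwards [h2.eventually h1] with t ht
    simp only [neg_inj, neg_eq_iff_eq_neg (a := sg _)] at ht
    rw [← hcard]; exact ht
  -- The corrected count has no jumps. `N` omits points with `h = 1`, so an entry is first counted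
  -- after its level (hence `<`), and an exit is already lost at its level (hence `≤`).
  set g : ℝ → ℤ := fun t => N t - (B.filter fun x => s x < t ∧ sg x = 1).card +
    (B.filter fun x => s x ≤ t ∧ sg x = -1).card with hg
  have hnear : ∀ t₀, ∀ᶠ t in 𝓝 t₀, ∀ x ∈ B, (t₀ < s x → t < s x) ∧ (s x < t₀ → s x < t) := by
    intro t₀
    rw [eventually_all_finset]
    intro x hx
    rcases lt_trichotomy t₀ (s x) with h1 | h1 | h1
    · filter_upwards [eventually_lt_nhds h1] with t ht
      exact ⟨fun _ => ht, fun h => absurd h h1.not_gt⟩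
    · exact Eventually.of_forall fun t => ⟨fun h => absurd h1 h.ne, fun h => absurd h1 h.ne'⟩
    · filter_upwards [eventually_gt_nhds h1] with t ht
      exact ⟨fun h => absurd h h1.not_gt, fun _ => ht⟩
  have hgR : ∀ t₀, ∀ᶠ t in 𝓝[>] t₀, g t = g t₀ := by
    intro t₀
    filter_upwards [hR t₀, nhdsWithin_le_nhds (hnear t₀), self_mem_nhdsWithin]
      with t h1 h2 (h3 : t₀ < t)
    have e1 : (B.filter fun x => s x < t ∧ sg x = 1) =
        (B.filter fun x => s x < t₀ ∧ sg x = 1) ∪ (B.filter fun x => s x = t₀ ∧ sg x = 1) := by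
      ext x
      simp only [Finset.mem_filter, Finset.mem_union]
      constructor
      · rintro ⟨hx, h4, h5⟩
        rcases lt_trichotomy (s x) t₀ with h6 | h6 | h6
        · exact Or.inl ⟨hx, h6, h5⟩
        · exact Or.inr ⟨hx, h6, h5⟩
        · exact absurd ((h2 x hx).1 h6) h4.not_gt
      · rintro (⟨hx, h4, h5⟩ | ⟨hx, h4, h5⟩)
        · exact ⟨hx, h4.trans h3, h5⟩
        · exact ⟨hx, h4 ▸ h3, h5⟩
    have e2 : (B.filter fun x => s x ≤ t ∧ sg x = -1) =
        (B.filter fun x => s x ≤ t₀ ∧ sg x = -1) := by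
      ext x
      simp only [Finset.mem_filter]
      refine and_congr_right fun hx => and_congr_left fun _ => ⟨fun h4 => ?_, fun h4 => h4.trans h3.le⟩
      by_contra h5
      exact absurd ((h2 x hx).1 (not_le.1 h5)) h4.not_gt
    simp only [hg]
    rw [e1, e2, h1, Finset.card_union_of_disjoint]
    · push_cast; ring
    · rw [Finset.disjoint_filter]
      rintro x - ⟨h4, -⟩ ⟨h5, -⟩
      exact absurd h5 h4.ne
  have hgL : ∀ t₀, ∀ᶠ t in 𝓝[<] t₀, g t = g t₀ := by
    intro t₀
    filter_upwards [hL t₀, nhdsWithin_le_nhds (hnear t₀), self_mem_nhdsWithin]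
      with t h1 h2 (h3 : t < t₀)
    have e1 : (B.filter fun x => s x ≤ t₀ ∧ sg x = -1) =
        (B.filter fun x => s x ≤ t ∧ sg x = -1) ∪ (B.filter fun x => s x = t₀ ∧ sg x = -1) := by
      ext x
      simp only [Finset.mem_filter, Finset.mem_union]
      constructor
      · rintro ⟨hx, h4, h5⟩
        rcases h4.lt_or_eq with h6 | h6
        · exact Or.inl ⟨hx, ((h2 x hx).2 h6).le, h5⟩
        · exact Or.inr ⟨hx, h6, h5⟩
      · rintro (⟨hx, h4, h5⟩ | ⟨hx, h4, h5⟩)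
        · exact ⟨hx, h4.trans h3.le, h5⟩
        · exact ⟨hx, h4.le, h5⟩
    have e2 : (B.filter fun x => s x < t ∧ sg x = 1) =
        (B.filter fun x => s x < t₀ ∧ sg x = 1) := by
      ext x
      simp only [Finset.mem_filter]
      exact and_congr_right fun hx => and_congr_left fun _ =>
        ⟨fun h4 => h4.trans h3, fun h4 => (h2 x hx).2 h4⟩
    simp only [hg]
    rw [e1, e2, h1, Finset.card_union_of_disjoint]
    · push_cast; ring
    · rw [Finset.disjoint_filter]
      rintro x - ⟨h4, -⟩ ⟨h5, -⟩
      exact absurd h5 (h4.trans_lt h3).ne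
  have hlc : IsLocallyConstant g := by
    rw [IsLocallyConstant.iff_eventually_eq]
    intro t₀
    rw [← nhdsLT_sup_nhdsGE, ← Ioi_union_left (a := t₀), nhdsWithin_union, nhdsWithin_singleton]
    refine eventually_sup.2 ⟨hgL t₀, eventually_sup.2 ⟨hgR t₀, ?_⟩⟩
    simp
  -- Beyond the bounds of `s` on the compact region `N` vanishes, so comparing `g` on the two sides
  -- leaves only the signed number of crossings.
  obtain ⟨m, hm⟩ := (hA.image hs).bddBelow
  obtain ⟨M, hM⟩ := (hA.image hs).bddAbove
  have hlow : g (m - 1) = 0 := by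
    have h0 : N (m - 1) = 0 := by
      simp only [hN]
      rw [show {x | s x = m - 1 ∧ 1 < h x} = ∅ from ?_, ncard_empty]
      refine eq_empty_of_forall_notMem fun x hx => ?_
      have := hm ⟨x, hx.2.le, rfl⟩
      linarith [hx.1]
    have h1 : ∀ x ∈ B, m ≤ s x := fun x hx => hm ⟨x, by simp [hB] at hx; exact hx.ge, rfl⟩
    simp only [hg]
    rw [h0, Finset.filter_false_of_mem, Finset.filter_false_of_mem]
    · simp
    · intro x hx h; linarith [h.1, h1 x hx]
    · intro x hx h; linarith [h.1, h1 x hx]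
  have hhigh : g (M + 1) = -(B.filter fun x => sg x = 1).card + (B.filter fun x => sg x = -1).card := by
    have h0 : N (M + 1) = 0 := by
      simp only [hN]
      rw [show {x | s x = M + 1 ∧ 1 < h x} = ∅ from ?_, ncard_empty]
      refine eq_empty_of_forall_notMem fun x hx => ?_
      have := hM ⟨x, hx.2.le, rfl⟩
      linarith [hx.1]
    have h1 : ∀ x ∈ B, s x ≤ M := fun x hx => hM ⟨x, by simp [hB] at hx; exact hx.ge, rfl⟩
    simp only [hg]
    have e1 : (B.filter fun x => s x < M + 1 ∧ sg x = 1) = B.filter fun x => sg x = 1 :=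
      Finset.filter_congr fun x hx => and_iff_right (by linarith [h1 x hx])
    have e2 : (B.filter fun x => s x ≤ M + 1 ∧ sg x = -1) = B.filter fun x => sg x = -1 :=
      Finset.filter_congr fun x hx => and_iff_right (by linarith [h1 x hx])
    rw [h0, e1, e2]
    simp
  have hconst := hlc.apply_eq_of_isPreconnected isPreconnected_univ
    (mem_univ (m - 1)) (mem_univ (M + 1))
  rw [hlow, hhigh] at hconst
  rw [finsum_mem_eq_finite_toFinset_sum _ hBfin]
  have hsum : ∀ x ∈ B, sg x = (if sg x = 1 then 1 else 0) - (if sg x = -1 then 1 else 0) := by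
    intro x hx
    rcases hsg' x hx with h1 | h1 <;> simp [h1]
  rw [Finset.sum_congr rfl hsum, Finset.sum_sub_distrib, Finset.sum_boole, Finset.sum_boole]
  linarith

end Counting

/-! ### Immersions between `4`-manifolds and the inverse function theorem -/

section Charts

variable {M : Type*} [TopologicalSpace M] [ChartedSpace R4 M]

/-- In adapted charts an immersion is an inclusion into a product. Projecting back gives a smooth
local left inverse `G`, and differentiating `G ∘ f = id` gives injectivity. -/
theorem injective_mfderiv_of_isImmersionAt {N : Type*} [TopologicalSpace N] [ChartedSpace R4 N]
    {f : M → N} {x : M} (h : Manifold.IsImmersionAt (𝓡 4) (𝓡 4) ∞ f x) :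
    Function.Injective (mfderiv (𝓡 4) (𝓡 4) f x) := by
  set π : R4 → R4 := fun z => (h.equiv.symm z).1 with hπ
  have hπs : ContMDiff (𝓡 4) (𝓡 4) ∞ π := by
    rw [contMDiff_iff_contDiff]
    exact contDiff_fst.comp h.equiv.symm.contDiff
  set G : N → M := h.domChart.symm ∘ π ∘ h.codChart with hG
  have hcomp : ∀ᶠ y in 𝓝 x, G (f y) = y := by
    filter_upwards [h.domChart.open_source.mem_nhds h.mem_domChart_source] with y hy
    have h0 : h.domChart y ∈ (h.domChart.extend (𝓡 4)).target := by
      simpa using h.domChart.map_source hy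
    have h1 := h.writtenInCharts h0
    simp [h.domChart.left_inv hy] at h1
    simp [hG, hπ, h1, h.domChart.left_inv hy]
  have h1 : π (h.codChart (f x)) = h.domChart x := by
    have h0 : h.domChart x ∈ (h.domChart.extend (𝓡 4)).target := by
      simpa using h.domChart.map_source h.mem_domChart_source
    have h1 := h.writtenInCharts h0
    simp [h.domChart.left_inv h.mem_domChart_source] at h1
    simp [hπ, h1]
  have hGd : MDifferentiableAt (𝓡 4) (𝓡 4) G (f x) := by
    refine ContMDiffAt.mdifferentiableAt (n := ∞) ?_ (by simp)
    refine ContMDiffAt.comp (I' := 𝓡 4) (f x) ?_ (ContMDiffAt.comp (I' := 𝓡 4) (f x) hπs.contMDiffAt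
      (contMDiffAt_of_mem_maximalAtlas h.codChart_mem_maximalAtlas h.mem_codChart_source))
    refine contMDiffAt_symm_of_mem_maximalAtlas h.domChart_mem_maximalAtlas ?_
    change π (h.codChart (f x)) ∈ _
    rw [h1]
    exact h.domChart.map_source h.mem_domChart_source
  have hfd : MDifferentiableAt (𝓡 4) (𝓡 4) f x := h.contMDiffAt.mdifferentiableAt (by simp)
  intro v w hvw
  have key : ∀ v, mfderiv (𝓡 4) (𝓡 4) G (f x) (mfderiv (𝓡 4) (𝓡 4) f x v) = v := by
    intro v
    have h2 : mfderiv (𝓡 4) (𝓡 4) (G ∘ f) x = mfderiv (𝓡 4) (𝓡 4) id x :=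
      Filter.EventuallyEq.mfderiv_eq hcomp
    have h3 := mfderiv_comp_apply x hGd hfd v
    rw [← h3, h2, mfderiv_id]
    rfl
  have h4 := congrArg (mfderiv (𝓡 4) (𝓡 4) G (f x)) hvw
  rw [key, key] at h4
  exact h4

variable [IsManifold (𝓡 4) ∞ M] {E : Type*} [NormedAddCommGroup E] [NormedSpace ℝ E]

theorem contDiffAt_comp_chart_symm {x₀ x : M} (hx : x ∈ (chartAt R4 x₀).source) {f : M → E}
    (hf : ContMDiffAt (𝓡 4) 𝓘(ℝ, E) ∞ f x) :
    ContDiffAt ℝ ∞ (f ∘ (chartAt R4 x₀).symm) (chartAt R4 x₀ x) := by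
  rw [← contMDiffAt_iff_contDiffAt]
  refine ContMDiffAt.comp _ ?_ (contMDiffAt_symm_of_mem_maximalAtlas
    (IsManifold.chart_mem_maximalAtlas x₀) ((chartAt R4 x₀).map_source hx))
  rwa [(chartAt R4 x₀).left_inv hx]

theorem mfderiv_comp_chart_symm {x₀ x : M} (hx : x ∈ (chartAt R4 x₀).source) {f : M → E}
    (hf : MDifferentiableAt (𝓡 4) 𝓘(ℝ, E) f x) (v : R4) :
    fderiv ℝ (f ∘ (chartAt R4 x₀).symm) (chartAt R4 x₀ x) v =
      mfderiv (𝓡 4) 𝓘(ℝ, E) f x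
        (mfderiv (𝓡 4) (𝓡 4) (chartAt R4 x₀).symm (chartAt R4 x₀ x) v) := by
  rw [← mfderiv_eq_fderiv]
  have h1 : MDifferentiableAt (𝓡 4) (𝓡 4) (chartAt R4 x₀).symm (chartAt R4 x₀ x) :=
    (contMDiffAt_symm_of_mem_maximalAtlas (n := ∞)
      (IsManifold.chart_mem_maximalAtlas x₀) ((chartAt R4 x₀).map_source hx)).mdifferentiableAt
      (by simp)
  have h2 : (chartAt R4 x₀).symm (chartAt R4 x₀ x) = x := (chartAt R4 x₀).left_inv hx
  have h3 := mfderiv_comp_apply_of_eq (x := chartAt R4 x₀ x) (y := x) hf h1 h2 v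
  rw [h2] at h3
  exact h3

theorem injective_fderiv_comp_chart_symm {x₀ x : M} (hx : x ∈ (chartAt R4 x₀).source) {f : M → E}
    (hf : MDifferentiableAt (𝓡 4) 𝓘(ℝ, E) f x)
    (hi : Function.Injective (mfderiv (𝓡 4) 𝓘(ℝ, E) f x)) :
    Function.Injective (fderiv ℝ (f ∘ (chartAt R4 x₀).symm) (chartAt R4 x₀ x)) := by
  intro v w hvw
  rw [mfderiv_comp_chart_symm hx hf, mfderiv_comp_chart_symm hx hf] at hvw
  have : IsManifold (𝓡 4) 1 M := IsManifold.of_le (n := ∞) (by simp)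
  refine (mdifferentiable_chart (I := 𝓡 4) x₀).symm.mfderiv_injective
    ((chartAt R4 x₀).map_source hx) (hi ?_)
  exact hvw

/-- The trivialization at `x₀` is the differential of the chart at `x₀`, so this is the ordinary
derivative of `f` read in that chart, in a constant direction. -/
theorem continuousAt_mfderiv_symmL {x₀ : M} {f : M → E}
    (hf : ∀ᶠ x in 𝓝 x₀, ContMDiffAt (𝓡 4) 𝓘(ℝ, E) ∞ f x) (v : R4) :
    ContinuousAt (fun x => (mfderiv (𝓡 4) 𝓘(ℝ, E) f x
      ((trivializationAt R4 (TangentSpace (𝓡 4) : M → Type) x₀).symmL ℝ x v) : E)) x₀ := by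
  have : IsManifold (𝓡 4) 1 M := IsManifold.of_le (n := ∞) (by simp)
  have hx₀ := mem_chart_source R4 x₀
  have h1 : ContDiffAt ℝ 1 (f ∘ (chartAt R4 x₀).symm) (chartAt R4 x₀ x₀) :=
    (contDiffAt_comp_chart_symm hx₀ hf.self_of_nhds).of_le (by simp)
  have h2 : ContinuousAt (fun x => fderiv ℝ (f ∘ (chartAt R4 x₀).symm) (chartAt R4 x₀ x) v) x₀ :=
    ContinuousAt.clm_apply (ContinuousAt.comp (f := chartAt R4 x₀) (x := x₀)
      (h1.fderiv_right (m := 0) (by simp)).continuousAt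
      ((chartAt R4 x₀).continuousAt hx₀)) continuousAt_const
  refine h2.congr ?_
  filter_upwards [hf, (chartAt R4 x₀).open_source.mem_nhds hx₀] with x hx hxs
  rw [mfderiv_comp_chart_symm hxs (hx.mdifferentiableAt (by simp)),
    TangentBundle.symmL_trivializationAt hxs]
  simp only [extChartAt, mfderivWithin_univ, mfld_simps]
  rfl

theorem exists_continuousLinearEquiv_of_injective [FiniteDimensional ℝ E] (A : E →L[ℝ] E)
    (hA : Function.Injective A) : ∃ L : E ≃L[ℝ] E, (L : E →L[ℝ] E) = A :=
  ⟨(LinearEquiv.ofInjectiveEndo A.toLinearMap hA).toContinuousLinearEquiv, by ext; rfl⟩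

/-- Inverse function theorem on a `4`-manifold. -/
theorem exists_chart_of_injective_mfderiv {f : M → R4} {U : Set M} (hU : IsOpen U)
    (hf : ∀ x ∈ U, ContMDiffAt (𝓡 4) (𝓡 4) ∞ f x)
    (hi : ∀ x ∈ U, Function.Injective (mfderiv (𝓡 4) (𝓡 4) f x)) {x₀ : M} (hx₀ : x₀ ∈ U) :
    ∃ e ∈ IsManifold.maximalAtlas (𝓡 4) ∞ M, x₀ ∈ e.source ∧ e.source ⊆ U ∧
      EqOn f e e.source := by
  have hderiv : ∀ x ∈ U, x ∈ (chartAt R4 x₀).source → ∃ L : R4 ≃L[ℝ] R4,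
      HasFDerivAt (f ∘ (chartAt R4 x₀).symm) (L : R4 →L[ℝ] R4) (chartAt R4 x₀ x) := by
    intro x hx hxs
    have h1 := injective_fderiv_comp_chart_symm hxs ((hf x hx).mdifferentiableAt (by simp))
      (hi x hx)
    obtain ⟨L, hL⟩ := exists_continuousLinearEquiv_of_injective _ h1
    refine ⟨L, ?_⟩
    rw [hL]
    exact ((contDiffAt_comp_chart_symm hxs (hf x hx)).differentiableAt (by simp)).hasFDerivAt
  have hx₀s := mem_chart_source R4 x₀
  obtain ⟨L, hL⟩ := hderiv x₀ hx₀ hx₀s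
  have hc := contDiffAt_comp_chart_symm hx₀s (hf x₀ hx₀)
  set e₀ := hc.toOpenPartialHomeomorph _ hL (by simp) with he₀
  have he₀c : ∀ z, e₀ z = f ((chartAt R4 x₀).symm z) := fun z => rfl
  set e := ((chartAt R4 x₀).trans e₀).restrOpen U hU with he
  have hmem : ∀ x, x ∈ e.source ↔ (x ∈ (chartAt R4 x₀).source ∧ chartAt R4 x₀ x ∈ e₀.source) ∧
      x ∈ U := by
    intro x
    simp [he]
  have heq : EqOn f e e.source := by
    intro x hx
    obtain ⟨⟨h1, h2⟩, h3⟩ := (hmem x).1 hx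
    change f x = e₀ (chartAt R4 x₀ x)
    rw [he₀c, (chartAt R4 x₀).left_inv h1]
  refine ⟨e, ?_, ?_, fun x hx => ((hmem x).1 hx).2, heq⟩
  · refine OpenPartialHomeomorph.mem_maximalAtlas_of_contMDiffOn e ?_ ?_
    · intro x hx
      exact ((hf x ((hmem x).1 hx).2).contMDiffWithinAt).congr (fun y hy => (heq hy).symm)
        (heq hx).symm
    · intro z hz
      have hx := e.map_target hz
      obtain ⟨⟨h1, h2⟩, h3⟩ := (hmem _).1 hx
      -- The inverse has to be smooth on the whole target, so the invertible derivative is needed at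
      -- each point of `U` and not only at `x₀`.
      obtain ⟨L', hL'⟩ := hderiv _ h3 h1
      have hz' : z ∈ e₀.target := by
        have : e (e.symm z) = z := e.right_inv hz
        rw [← this]
        exact e₀.map_source h2
      have hsymm : chartAt R4 x₀ (e.symm z) = e₀.symm z := by
        have h4 : e₀ (chartAt R4 x₀ (e.symm z)) = z := e.right_inv hz
        rw [← h4, e₀.left_inv h2, h4]
      rw [hsymm] at hL'
      have h5 : ContDiffAt ℝ ∞ e₀.symm z := by
        refine e₀.contDiffAt_symm hz' hL' ?_
        rw [← hsymm]
        exact contDiffAt_comp_chart_symm h1 (hf _ h3)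
      refine ContMDiffAt.contMDiffWithinAt ?_
      change ContMDiffAt (𝓡 4) (𝓡 4) ∞ ((chartAt R4 x₀).symm ∘ e₀.symm) z
      refine ContMDiffAt.comp z ?_ h5.contMDiffAt
      refine contMDiffAt_symm_of_mem_maximalAtlas (IsManifold.chart_mem_maximalAtlas x₀) ?_
      rw [← hsymm]
      exact (chartAt R4 x₀).map_source h1
  · rw [hmem]
    exact ⟨⟨hx₀s, hc.mem_toOpenPartialHomeomorph_source hL (by simp)⟩, hx₀⟩

/-- In equal dimensions `f` is locally a chart of `M`. Read in that chart it is the identity, with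
trivial complement. -/
theorem isImmersion_of_injective_mfderiv {f : M → R4} (hf : ContMDiff (𝓡 4) (𝓡 4) ∞ f)
    (hi : ∀ x, Function.Injective (mfderiv (𝓡 4) (𝓡 4) f x)) :
    Manifold.IsImmersion (𝓡 4) (𝓡 4) ∞ f := by
  refine Manifold.IsImmersionOfComplement.isImmersion (F := PUnit) fun x => ?_
  obtain ⟨e, he, hx, -, heq⟩ := exists_chart_of_injective_mfderiv isOpen_univ
    (fun x _ => hf x) (fun x _ => hi x) (mem_univ x)
  refine Manifold.IsImmersionAtOfComplement.mk_of_continuousAt hf.continuous.continuousAt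
    (.prodUnique ℝ R4 _) e (OpenPartialHomeomorph.refl R4) hx (by simp) he
    (IsManifold.subset_maximalAtlas (by simp)) ?_
  intro z hz
  have hz' : z ∈ e.target := by simpa using hz
  have : f (e.symm z) = z := by rw [heq (e.map_target hz'), e.right_inv hz']
  simpa using this

end Charts

/-! ### Signs of top forms on an oriented manifold -/

section Orientation

variable {M : Type*} [TopologicalSpace M] [ChartedSpace R4 M]

theorem topForm_eq_det_mul {x : M} (η : TopForm4 x) (b : Module.Basis (Fin 4) ℝ (T4 x))
    (v : Fin 4 → T4 x) : η v = b.det v * η b := by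
  conv_lhs => rw [η.eq_smul_basis_det b]
  simp [mul_comm]

theorem topForm_eq_zero_iff {x : M} (η : TopForm4 x) (b : Module.Basis (Fin 4) ℝ (T4 x)) :
    η = 0 ↔ η b = 0 := by
  constructor
  · rintro rfl; rfl
  · intro h; rw [η.eq_smul_basis_det b, h, zero_smul]

variable [IsManifold (𝓡 4) ∞ M] (o : Orientation4 M)

namespace Orientation4

theorem exists_basis (x : M) :
    ∃ b : Module.Basis (Fin 4) ℝ (T4 x), b.orientation = o.orient x := by
  have h : Fintype.card (Fin 4) = Module.finrank ℝ (T4 x) := by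
    change _ = Module.finrank ℝ R4
    simp
  have : FiniteDimensional ℝ (T4 x) := inferInstanceAs (FiniteDimensional ℝ R4)
  exact ⟨(o.orient x).someBasis h, (o.orient x).someBasis_orientation h⟩

variable {o} {x : M} {b : Module.Basis (Fin 4) ℝ (T4 x)}

theorem pos_iff (hb : b.orientation = o.orient x) (η : TopForm4 x) : o.Pos η ↔ 0 < η b := by
  refine ⟨fun h => h b hb, fun h b' hb' => ?_⟩
  rw [topForm_eq_det_mul η b]
  exact mul_pos ((b.orientation_eq_iff_det_pos b').1 (hb.trans hb'.symm)) h

variable (o)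

theorem not_pos_neg {η : TopForm4 x} (h : o.Pos η) : ¬ o.Pos (-η) := by
  obtain ⟨b, hb⟩ := o.exists_basis x
  intro h'
  have h1 := h b hb
  have h2 := h' b hb
  rw [AlternatingMap.neg_apply] at h2
  linarith

variable {o}

theorem Pos.smul {η : TopForm4 x} (h : o.Pos η) {k : ℝ} (hk : 0 < k) : o.Pos (k • η) := by
  intro b hb
  rw [AlternatingMap.smul_apply, smul_eq_mul]
  exact mul_pos hk (h b hb)

theorem sign_smul_of_pos {η : TopForm4 x} (h : o.Pos η) {k : ℝ} (hk : 0 < k) :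
    o.sign (k • η) = 1 := by
  rw [sign, if_pos (h.smul hk)]

theorem sign_smul_of_neg {η : TopForm4 x} (h : o.Pos η) {k : ℝ} (hk : k < 0) :
    o.sign (k • η) = -1 := by
  have h1 : o.Pos (-(k • η)) := by
    rw [show -(k • η) = (-k) • η by ext v; simp]
    exact h.smul (by linarith)
  have h2 : ¬ o.Pos (k • η) := by
    have := o.not_pos_neg h1
    rwa [neg_neg] at this
  rw [sign, if_neg h2, if_pos h1]

variable (o)

theorem pos_or_pos_neg {η : TopForm4 x} (h : η ≠ 0) : o.Pos η ∨ o.Pos (-η) := by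
  obtain ⟨b, hb⟩ := o.exists_basis x
  rw [pos_iff hb, pos_iff hb, AlternatingMap.neg_apply, Left.neg_pos_iff]
  exact (lt_or_gt_of_ne ((topForm_eq_zero_iff η b).not.1 h)).symm

/-- Near every point there is a continuous positively oriented frame. -/
theorem exists_frame (x₀ : M) : ∃ b₀ : Fin 4 → R4, ∀ᶠ x in 𝓝 x₀,
    ∃ b : Module.Basis (Fin 4) ℝ (T4 x), b.orientation = o.orient x ∧
      ∀ i, b i = (trivializationAt R4 (TangentSpace (𝓡 4) : M → Type) x₀).symmL ℝ x (b₀ i) := by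
  obtain ⟨o₀, ho₀⟩ := o.locally_constant x₀
  have h : Fintype.card (Fin 4) = Module.finrank ℝ R4 := by simp
  refine ⟨o₀.someBasis h, ?_⟩
  filter_upwards [ho₀, (trivializationAt R4 (TangentSpace (𝓡 4) : M → Type) x₀).open_baseSet.mem_nhds
    (FiberBundle.mem_baseSet_trivializationAt' x₀)] with x hx hxb
  set L := (trivializationAt R4 (TangentSpace (𝓡 4) : M → Type) x₀).continuousLinearEquivAt ℝ x hxb
    with hL
  refine ⟨(o₀.someBasis h).map L.symm.toLinearEquiv, ?_, fun i => ?_⟩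
  · have h1 := Module.Basis.orientation_map (o₀.someBasis h) L.symm.toLinearEquiv
    rw [h1, o₀.someBasis_orientation h, ← hx hxb]
    exact (Orientation.map (Fin 4) L.toLinearEquiv).symm_apply_apply (o.orient x)
  · rw [Module.Basis.map_apply]
    exact congrFun ((trivializationAt R4
      (TangentSpace (𝓡 4) : M → Type) x₀).symm_continuousLinearEquivAt_eq hxb) _

theorem eventually_pos {η : ∀ x : M, TopForm4 x} {x₀ : M}
    (hη : ∀ b₀ : Fin 4 → R4, ContinuousAt (fun x => η x fun i =>
      (trivializationAt R4 (TangentSpace (𝓡 4) : M → Type) x₀).symmL ℝ x (b₀ i)) x₀)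
    (h : o.Pos (η x₀)) : ∀ᶠ x in 𝓝 x₀, o.Pos (η x) := by
  obtain ⟨b₀, hb₀⟩ := o.exists_frame x₀
  obtain ⟨b, hb, hbe⟩ := hb₀.self_of_nhds
  have h1 := (pos_iff hb _).1 h
  rw [show (b : Fin 4 → T4 x₀) = _ from funext hbe] at h1
  filter_upwards [hb₀, (hη b₀).eventually (lt_mem_nhds h1)] with x ⟨b', hb', hbe'⟩ hx
  rw [pos_iff hb', show (b' : Fin 4 → T4 x) = _ from funext hbe']
  exact hx

end Orientation4

end Orientation

/-! ### Pull-backs of volume forms as determinants -/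

section DetAlong

variable {M : Type*} [TopologicalSpace M] [ChartedSpace R4 M]

/-- The pull-back of the standard volume form of `ℝ⁴` by `F`. -/
def detAlong (F : M → R4) (x : M) : TopForm4 x :=
  (EuclideanSpace.basisFun (Fin 4) ℝ).toBasis.det.compLinearMap
    (mfderiv (𝓡 4) (𝓡 4) F x).toLinearMap

theorem detAlong_apply (F : M → R4) (x : M) (v : Fin 4 → T4 x) :
    detAlong F x v = (EuclideanSpace.basisFun (Fin 4) ℝ).toBasis.det
      (fun i => (mfderiv (𝓡 4) (𝓡 4) F x (v i) : R4)) := rfl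

theorem detAlong_of_mfderiv_eq_comp {F G : M → R4} {x : M} (A : R4 →ₗ[ℝ] R4)
    (h : ∀ v, (mfderiv (𝓡 4) (𝓡 4) F x v : R4) = A (mfderiv (𝓡 4) (𝓡 4) G x v)) :
    detAlong F x = LinearMap.det A • detAlong G x := by
  ext v
  rw [detAlong_apply, AlternatingMap.smul_apply, detAlong_apply, smul_eq_mul]
  refine Eq.trans ?_ (Module.Basis.det_comp (EuclideanSpace.basisFun (Fin 4) ℝ).toBasis A
    (fun i => (mfderiv (𝓡 4) (𝓡 4) G x (v i) : R4)))
  exact congrArg _ (funext fun i => h (v i))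

/-- An alternating form vanishes on dependent vectors. If it is nonzero on `A ∘ v`, then `A ∘ v` is
independent; so is `v`, which is then a basis for dimension reasons, and `A` has no kernel. -/
theorem injective_of_compLinearMap_ne_zero {V W : Type*} [AddCommGroup V] [Module ℝ V]
    [AddCommGroup W] [Module ℝ W] (hV : Module.finrank ℝ V = 4)
    (η : W [⋀^Fin 4]→ₗ[ℝ] ℝ) (A : V →ₗ[ℝ] W)
    (h : η.compLinearMap A ≠ 0) : Function.Injective A := by
  have : FiniteDimensional ℝ V := Module.finite_of_finrank_pos (by omega)
  have h0 : ∃ v, η.compLinearMap A v ≠ 0 := by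
    by_contra! h1
    exact h (AlternatingMap.ext h1)
  obtain ⟨v, hv⟩ := h0
  have h1 : LinearIndependent ℝ (A ∘ v) := by
    by_contra h2
    exact hv (η.map_linearDependent _ h2)
  have h2 : LinearIndependent ℝ v := LinearIndependent.of_comp A h1
  have h3 := h2.span_eq_top_of_card_eq_finrank (by simp [hV])
  rw [← LinearMap.ker_eq_bot, LinearMap.ker_eq_bot']
  intro m hm
  have h5 : m ∈ Submodule.span ℝ (range v) := h3 ▸ Submodule.mem_top
  obtain ⟨c, rfl⟩ := (Submodule.mem_span_range_iff_exists_fun ℝ).1 h5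
  simp only [map_sum, map_smul] at hm
  have h4 := (Fintype.linearIndependent_iff.1 h1) c hm
  simp [h4]

theorem injective_mfderiv_of_pullbackVolume_ne_zero {φ : M → S4} {x : M}
    (h : pullbackVolume φ x ≠ 0) : Function.Injective (mfderiv (𝓡 4) (𝓡 4) φ x) :=
  injective_of_compLinearMap_ne_zero (show Module.finrank ℝ R4 = 4 by simp) _ _ h

theorem injective_mfderiv_of_detAlong_ne_zero {F : M → R4} {x : M}
    (h : detAlong F x ≠ 0) : Function.Injective (mfderiv (𝓡 4) (𝓡 4) F x) :=
  injective_of_compLinearMap_ne_zero (show Module.finrank ℝ R4 = 4 by simp) _ _ h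

theorem R4.injective_iff_surjective (A : R4 →ₗ[ℝ] R4) :
    Function.Injective A ↔ Function.Surjective A := LinearMap.injective_iff_surjective

theorem detAlong_ne_zero_of_injective {F : M → R4} {x : M}
    (h : Function.Injective (mfderiv (𝓡 4) (𝓡 4) F x)) : detAlong F x ≠ 0 := by
  have hs : Function.Surjective (mfderiv (𝓡 4) (𝓡 4) F x) :=
    (R4.injective_iff_surjective (mfderiv (𝓡 4) (𝓡 4) F x).toLinearMap).1 h
  choose v hv using fun i => hs ((EuclideanSpace.basisFun (Fin 4) ℝ).toBasis i)
  intro h0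
  have h1 := congrArg (fun η => η v) h0
  simp only [detAlong_apply, hv, AlternatingMap.zero_apply] at h1
  exact one_ne_zero (((EuclideanSpace.basisFun (Fin 4) ℝ).toBasis.det_self).symm.trans h1)

theorem curryLeft_compLinearMap_apply {V W : Type*} [AddCommGroup V] [Module ℝ V]
    [AddCommGroup W] [Module ℝ W] {n : ℕ} (η : W [⋀^Fin (n + 1)]→ₗ[ℝ] ℝ) (u : W) (A : V →ₗ[ℝ] W)
    (w : Fin n → V) :
    (η.curryLeft u).compLinearMap A w = η (Fin.cons u fun i => A (w i)) := rfl

/-- Viewing `φ` as a map to `ℝ⁵` puts all vectors in one fixed space; both continuity and the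
Jacobian of the central projection are read off from this determinant. -/
theorem pullbackVolume_apply {φ : M → S4} {x : M} (hφ : MDifferentiableAt (𝓡 4) (𝓡 4) φ x)
    (v : Fin 4 → T4 x) :
    pullbackVolume φ x v = (3 / (8 * Real.pi ^ 2) : ℝ) *
      (EuclideanSpace.basisFun (Fin (4 + 1)) ℝ).toBasis.det
        (Fin.cons ((φ x : S4) : EuclideanSpace ℝ (Fin (4 + 1))) fun i =>
          (mfderiv (𝓡 4) 𝓘(ℝ, EuclideanSpace ℝ (Fin (4 + 1)))
            (fun y => ((φ y : S4) : EuclideanSpace ℝ (Fin (4 + 1)))) x (v i) :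
            EuclideanSpace ℝ (Fin (4 + 1)))) := by
  have h1 : MDifferentiableAt (𝓡 4) 𝓘(ℝ, EuclideanSpace ℝ (Fin (4 + 1)))
      (fun z : S4 => (z : EuclideanSpace ℝ (Fin (4 + 1)))) (φ x) :=
    (contMDiff_coe_sphere (m := 1) (φ x)).mdifferentiableAt one_ne_zero
  have h2 : ∀ i, mfderiv (𝓡 4) 𝓘(ℝ, EuclideanSpace ℝ (Fin (4 + 1)))
      (fun y => ((φ y : S4) : EuclideanSpace ℝ (Fin (4 + 1)))) x (v i) =
      mfderiv (𝓡 4) 𝓘(ℝ, EuclideanSpace ℝ (Fin (4 + 1)))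
      (fun z : S4 => (z : EuclideanSpace ℝ (Fin (4 + 1)))) (φ x)
        (mfderiv (𝓡 4) (𝓡 4) φ x (v i)) := fun i => mfderiv_comp_apply x h1 hφ (v i)
  rw [pullbackVolume, sphereVolumeForm, AlternatingMap.compLinearMap_apply,
    AlternatingMap.smul_apply, smul_eq_mul]
  refine congrArg _ ((curryLeft_compLinearMap_apply _ _ _ _).trans (congrArg _ ?_))
  exact congrArg (Fin.cons (α := fun _ => EuclideanSpace ℝ (Fin (4 + 1))) _)
    (funext fun i => (h2 i).symm)

theorem continuous_basisFun_det (n : ℕ) : Continuous fun v : Fin n → EuclideanSpace ℝ (Fin n) =>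
    (EuclideanSpace.basisFun (Fin n) ℝ).toBasis.det v := by
  simp only [Module.Basis.det_apply]
  refine Continuous.matrix_det ?_
  refine continuous_matrix fun i j => ?_
  simp only [Module.Basis.toMatrix_apply, OrthonormalBasis.coe_toBasis_repr_apply,
    EuclideanSpace.basisFun_repr]
  fun_prop

variable [IsManifold (𝓡 4) ∞ M]

theorem continuousAt_detAlong {F : M → R4} {x₀ : M}
    (hF : ∀ᶠ x in 𝓝 x₀, ContMDiffAt (𝓡 4) (𝓡 4) ∞ F x) (b₀ : Fin 4 → R4) :
    ContinuousAt (fun x => detAlong F x fun i =>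
      (trivializationAt R4 (TangentSpace (𝓡 4) : M → Type) x₀).symmL ℝ x (b₀ i)) x₀ := by
  have hw : ContinuousAt (fun x (i : Fin 4) => (mfderiv (𝓡 4) (𝓡 4) F x
      ((trivializationAt R4 (TangentSpace (𝓡 4) : M → Type) x₀).symmL ℝ x (b₀ i)) : R4)) x₀ :=
    continuousAt_pi.2 fun i => continuousAt_mfderiv_symmL hF (b₀ i)
  exact (continuous_basisFun_det 4).continuousAt.comp hw

theorem continuousAt_pullbackVolume {φ : M → S4} {x₀ : M}
    (hφ : ContMDiff (𝓡 4) (𝓡 4) ∞ φ) (b₀ : Fin 4 → R4) :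
    ContinuousAt (fun x => pullbackVolume φ x fun i =>
      (trivializationAt R4 (TangentSpace (𝓡 4) : M → Type) x₀).symmL ℝ x (b₀ i)) x₀ := by
  have hd : ∀ x, MDifferentiableAt (𝓡 4) (𝓡 4) φ x := fun x => hφ.mdifferentiableAt (by simp)
  have hc : ContMDiff (𝓡 4) 𝓘(ℝ, EuclideanSpace ℝ (Fin (4 + 1))) ∞
      (fun y => ((φ y : S4) : EuclideanSpace ℝ (Fin (4 + 1)))) := contMDiff_coe_sphere.comp hφ
  let w : M → Fin (4 + 1) → EuclideanSpace ℝ (Fin (4 + 1)) := fun x =>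
    Fin.cons ((φ x : S4) : EuclideanSpace ℝ (Fin (4 + 1))) fun i =>
      (mfderiv (𝓡 4) 𝓘(ℝ, EuclideanSpace ℝ (Fin (4 + 1)))
        (fun y => ((φ y : S4) : EuclideanSpace ℝ (Fin (4 + 1)))) x
        ((trivializationAt R4 (TangentSpace (𝓡 4) : M → Type) x₀).symmL ℝ x (b₀ i)) :
        EuclideanSpace ℝ (Fin (4 + 1)))
  have hw : ContinuousAt w x₀ := by
    refine continuousAt_pi.2 fun i => ?_
    refine Fin.cases ?_ (fun i => ?_) i
    · exact hc.continuous.continuousAt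
    · exact continuousAt_mfderiv_symmL (Eventually.of_forall fun x => hc x) (b₀ i)
  have h := ((continuous_basisFun_det (4 + 1)).continuousAt.comp hw).const_mul
    (3 / (8 * Real.pi ^ 2) : ℝ)
  exact h.congr (Eventually.of_forall fun x => (pullbackVolume_apply (hd x) _).symm)

end DetAlong

/-! ### Central projection of `ℝ⁴` to a hemisphere and its Jacobian -/

section CentralProjection

/-- The inclusion of `ℝ⁴` into `ℝ⁵` as the hyperplane where the first coordinate vanishes. -/
def hyperplaneIncl : R4 →L[ℝ] EuclideanSpace ℝ (Fin (4 + 1)) :=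
  LinearMap.toContinuousLinearMap
    { toFun := fun z => WithLp.toLp 2 (Fin.cons 0 z.ofLp)
      map_add' := fun z w => by
        ext i; refine Fin.cases ?_ (fun i => ?_) i <;> simp
      map_smul' := fun c z => by
        ext i; refine Fin.cases ?_ (fun i => ?_) i <;> simp }

@[simp] theorem hyperplaneIncl_zero (z : R4) : hyperplaneIncl z 0 = 0 := rfl

@[simp] theorem hyperplaneIncl_succ (z : R4) (i : Fin 4) : hyperplaneIncl z i.succ = z i := rfl

/-- The point `(1, z)` of `ℝ⁵`. -/
def affineIncl (z : R4) : EuclideanSpace ℝ (Fin (4 + 1)) :=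
  EuclideanSpace.single 0 1 + hyperplaneIncl z

@[simp] theorem affineIncl_zero (z : R4) : affineIncl z 0 = 1 := by simp [affineIncl]

@[simp] theorem affineIncl_succ (z : R4) (i : Fin 4) : affineIncl z i.succ = z i := by
  simp [affineIncl]

theorem norm_affineIncl_sq (z : R4) : ‖affineIncl z‖ ^ 2 = 1 + ‖z‖ ^ 2 := by
  rw [EuclideanSpace.norm_sq_eq, EuclideanSpace.norm_sq_eq, Fin.sum_univ_succ]
  simp

/-- The inverse length of `(1, z)`. -/
def projScale (z : R4) : ℝ := (Real.sqrt (1 + ‖z‖ ^ 2))⁻¹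

theorem projScale_pos (z : R4) : 0 < projScale z := by
  unfold projScale; positivity

theorem projScale_le_one (z : R4) : projScale z ≤ 1 := by
  refine inv_le_one_of_one_le₀ ?_
  rw [Real.one_le_sqrt]
  nlinarith [sq_nonneg ‖z‖]

theorem contDiff_projScale : ContDiff ℝ ∞ projScale := by
  unfold projScale
  refine ContDiff.inv (ContDiff.sqrt (contDiff_const.add (contDiff_norm_sq ℝ)) fun z => ?_)
    fun z => ?_ <;> positivity

theorem contDiff_affineIncl : ContDiff ℝ ∞ affineIncl :=
  contDiff_const.add hyperplaneIncl.contDiff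

theorem projScale_smul_affineIncl_mem (z : R4) :
    projScale z • affineIncl z ∈ Metric.sphere (0 : EuclideanSpace ℝ (Fin (4 + 1))) 1 := by
  rw [mem_sphere_zero_iff_norm, norm_smul, Real.norm_of_nonneg (projScale_pos z).le, projScale,
    ← norm_affineIncl_sq, Real.sqrt_sq (norm_nonneg _), inv_mul_cancel₀]
  intro h
  have := norm_affineIncl_sq z
  rw [h] at this
  nlinarith [sq_nonneg ‖z‖]

/-- Central projection of the affine hyperplane `{1} × ℝ⁴` to the unit sphere. -/
def centralProj : R4 → S4 :=
  Set.codRestrict (fun z => projScale z • affineIncl z) _ projScale_smul_affineIncl_mem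

theorem coe_centralProj (z : R4) :
    ((centralProj z : S4) : EuclideanSpace ℝ (Fin (4 + 1))) = projScale z • affineIncl z := rfl

theorem contMDiff_centralProj : ContMDiff (𝓡 4) (𝓡 4) ∞ centralProj :=
  ContMDiff.codRestrict_sphere (contDiff_projScale.smul contDiff_affineIncl).contMDiff _

theorem centralProj_injective : Function.Injective centralProj := by
  intro z w h
  have h1 : projScale z • affineIncl z = projScale w • affineIncl w := congrArg Subtype.val h
  have h2 : projScale z = projScale w := by
    simpa using congrArg (fun u : EuclideanSpace ℝ (Fin (4 + 1)) => u 0) h1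
  ext i
  have h3 := congrArg (fun u : EuclideanSpace ℝ (Fin (4 + 1)) => u i.succ) h1
  simp only [PiLp.smul_apply, affineIncl_succ, smul_eq_mul, h2] at h3
  exact mul_left_cancel₀ (projScale_pos w).ne' h3

theorem exists_notMem_range_centralProj : ∃ y : S4, ∀ z, centralProj z ≠ y := by
  refine ⟨-centralProj 0, fun z h => ?_⟩
  have h1 := congrArg (fun u : S4 => (u : EuclideanSpace ℝ (Fin (4 + 1))) 0) h
  simp only [coe_neg_sphere, coe_centralProj, PiLp.neg_apply, PiLp.smul_apply, affineIncl_zero,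
    smul_eq_mul, mul_one] at h1
  linarith [projScale_pos z, projScale_pos 0]

theorem fderiv_projScale_smul_affineIncl (z v : R4) :
    fderiv ℝ (fun z => projScale z • affineIncl z) z v =
      projScale z • hyperplaneIncl v + fderiv ℝ projScale z v • affineIncl z := by
  have h1 : HasFDerivAt affineIncl hyperplaneIncl z :=
    hyperplaneIncl.hasFDerivAt.const_add _
  have h2 : HasFDerivAt projScale (fderiv ℝ projScale z) z :=
    (contDiff_projScale.contDiffAt.differentiableAt (by simp)).hasFDerivAt
  have h3 : fderiv ℝ (fun z => projScale z • affineIncl z) z = _ := (h2.smul h1).fderiv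
  rw [h3]
  simp

theorem det_basisFun_eq (n : ℕ) (v : Fin n → EuclideanSpace ℝ (Fin n)) :
    (EuclideanSpace.basisFun (Fin n) ℝ).toBasis.det v =
      Matrix.det (Matrix.of fun i j => v i j) := by
  rw [← Matrix.det_transpose, Module.Basis.det_apply]
  rfl

theorem det_cons_affineIncl (z : R4) (a : ℝ) (ha : a ≠ 0) (t : Fin 4 → ℝ) (w : Fin 4 → R4) :
    (EuclideanSpace.basisFun (Fin (4 + 1)) ℝ).toBasis.det
      (Fin.cons (a • affineIncl z) fun i => a • hyperplaneIncl (w i) + t i • affineIncl z) =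
      a ^ 5 * (EuclideanSpace.basisFun (Fin 4) ℝ).toBasis.det w := by
  have hB : ∀ v : Fin (4 + 1) → EuclideanSpace ℝ (Fin (4 + 1)),
      v = Fin.cons (affineIncl z) (fun i => hyperplaneIncl (w i)) →
      Matrix.det (Matrix.of fun i j => v i j) =
        (EuclideanSpace.basisFun (Fin 4) ℝ).toBasis.det w := by
    rintro v rfl
    rw [Matrix.det_succ_column_zero, Fin.sum_univ_succ, det_basisFun_eq]
    simp only [Matrix.of_apply, Fin.cons_zero, Fin.cons_succ, hyperplaneIncl_zero, affineIncl_zero]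
    simp only [Fin.val_zero, pow_zero, one_mul, mul_zero, zero_mul, Finset.sum_const_zero, add_zero]
    congr 1
  rw [det_basisFun_eq, ← hB _ rfl]
  set B : Matrix (Fin (4 + 1)) (Fin (4 + 1)) ℝ := Matrix.of fun i j =>
    (Fin.cons (affineIncl z) (fun i => hyperplaneIncl (w i)) :
      Fin (4 + 1) → EuclideanSpace ℝ (Fin (4 + 1))) i j with hBdef
  have h1 : a ^ 5 * B.det = (a • B).det := by simp
  rw [h1]
  -- The terms in `affineIncl z` are multiples `t i / a` of row `0` of `a • B`, so row operations
  -- remove them.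
  refine Matrix.det_eq_of_forall_row_eq_smul_add_const (Fin.cons 0 fun i => t i / a) 0 rfl ?_
  intro i j
  refine Fin.cases ?_ (fun i => ?_) i
  · simp [hBdef]
  · simp only [hBdef, Matrix.of_apply, Fin.cons_succ, Fin.cons_zero, Matrix.smul_apply,
      PiLp.add_apply, PiLp.smul_apply, smul_eq_mul]
    field_simp

variable {M : Type*} [TopologicalSpace M] [ChartedSpace R4 M]

/-- The derivative of the scaling factor contributes only multiples of the position vector, which
already occupies the first slot of the determinant. What remains is a positive factor, so signs can
be computed in `ℝ⁴`. -/
theorem pullbackVolume_centralProj_comp {F : M → R4} {x : M}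
    (hF : MDifferentiableAt (𝓡 4) (𝓡 4) F x) :
    pullbackVolume (centralProj ∘ F) x =
      (3 / (8 * Real.pi ^ 2) * projScale (F x) ^ 5 : ℝ) • detAlong F x := by
  ext v
  have h1 : MDifferentiableAt (𝓡 4) (𝓡 4) centralProj (F x) :=
    contMDiff_centralProj.mdifferentiableAt (by simp)
  rw [pullbackVolume_apply (h1.comp x hF), AlternatingMap.smul_apply, smul_eq_mul, mul_assoc,
    detAlong_apply]
  congr 1
  refine Eq.trans ?_ (det_cons_affineIncl (F x) _ (projScale_pos (F x)).ne'
    (fun i => fderiv ℝ projScale (F x) (mfderiv (𝓡 4) (𝓡 4) F x (v i)))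
    (fun i => mfderiv (𝓡 4) (𝓡 4) F x (v i)))
  refine congrArg _ (congrArg (Fin.cons (α := fun _ => EuclideanSpace ℝ (Fin (4 + 1))) _)
    (funext fun i => ?_))
  have h2 : MDifferentiableAt (𝓡 4) 𝓘(ℝ, EuclideanSpace ℝ (Fin (4 + 1)))
      (fun z => projScale z • affineIncl z) (F x) :=
    ((contDiff_projScale.smul contDiff_affineIncl).contMDiff (F x)).mdifferentiableAt (by simp)
  have h3 := mfderiv_comp_apply x h2 hF (v i)
  rw [mfderiv_eq_fderiv] at h3
  exact h3.trans (fderiv_projScale_smul_affineIncl (F x) _)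

end CentralProjection

/-! ### Degree zero for cut-off immersions -/

section Degree

theorem eventually_crossing_of_hasDerivAt_pos {η : ℝ → ℝ} {D s₀ : ℝ} (h : HasDerivAt η D s₀)
    (hD : 0 < D) : ∀ᶠ t in 𝓝 s₀, (s₀ < t → η s₀ < η t) ∧ (t < s₀ → η t < η s₀) := by
  have h1 := (hasDerivAt_iff_tendsto_slope.1 h).eventually (lt_mem_nhds hD)
  rw [eventually_nhdsWithin_iff] at h1
  filter_upwards [h1] with t ht
  constructor
  · intro hlt
    have h2 := ht hlt.ne'
    rw [slope_def_field, div_pos_iff_of_pos_right (by linarith)] at h2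
    linarith
  · intro hlt
    have h2 := ht hlt.ne
    rw [slope_def_field, ← neg_div_neg_eq, div_pos_iff_of_pos_right (by linarith)] at h2
    linarith

theorem eventually_crossing_of_hasDerivAt_neg {η : ℝ → ℝ} {D s₀ : ℝ} (h : HasDerivAt η D s₀)
    (hD : D < 0) : ∀ᶠ t in 𝓝 s₀, (s₀ < t → η t < η s₀) ∧ (t < s₀ → η s₀ < η t) := by
  filter_upwards [eventually_crossing_of_hasDerivAt_pos h.neg (by linarith)] with t ht
  simpa using ht

/-- The map is `c` times a transvection, whose determinant is `1 + l w / c`. -/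
theorem det_smul_add_smulRight (c : ℝ) (hc : c ≠ 0) (l : R4 →ₗ[ℝ] ℝ) (w : R4) :
    LinearMap.det (c • LinearMap.id + l.smulRight w) = c ^ 3 * (c + l w) := by
  have h1 : c • LinearMap.id + l.smulRight w = c • LinearMap.transvection (c⁻¹ • l) w := by
    ext1 v
    simp [LinearMap.transvection.apply, smul_smul, hc]
  rw [h1, LinearMap.det_smul, LinearMap.transvection.det]
  simp
  field_simp

variable {M : Type*} [TopologicalSpace M] [ChartedSpace R4 M]

theorem contMDiff_smul_of_tsupport_subset {f : M → R4} {V : Set M}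
    (hf : ∀ x ∈ V, ContMDiffAt (𝓡 4) (𝓡 4) ∞ f x) {χ : M → ℝ}
    (hχ : ContMDiff (𝓡 4) 𝓘(ℝ, ℝ) ∞ χ) (hsupp : tsupport χ ⊆ V) :
    ContMDiff (𝓡 4) (𝓡 4) ∞ fun x => χ x • f x :=
  contMDiff_of_tsupport fun x hx =>
    (hχ x).smul (hf x (hsupp (tsupport_smul_subset_left χ f hx)))

/-- With `f` itself as the chart and `u = χ ∘ e.symm`, the map becomes `z ↦ u(z) z`, with derivative
`u(z) id + du ⊗ z`. -/
theorem detAlong_smul {f : M → R4} {χ : M → ℝ}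
    (hχ : ContMDiff (𝓡 4) 𝓘(ℝ, ℝ) ∞ χ) {e : OpenPartialHomeomorph M R4}
    (he : e ∈ IsManifold.maximalAtlas (𝓡 4) ∞ M) (hfe : EqOn f e e.source) {p : M}
    (hp : p ∈ e.source) (hχp : χ p ≠ 0) :
    DifferentiableAt ℝ (χ ∘ e.symm) (f p) ∧ detAlong (fun x => χ x • f x) p =
      (χ p ^ 3 * (χ p + fderiv ℝ (χ ∘ e.symm) (f p) (f p))) • detAlong f p := by
  have hfp : f p = e p := hfe hp
  have hu : ContMDiffAt (𝓡 4) 𝓘(ℝ, ℝ) ∞ (χ ∘ e.symm) (f p) := by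
    refine (hχ _).comp _ (contMDiffAt_symm_of_mem_maximalAtlas he ?_)
    rw [hfp]
    exact e.map_source hp
  have hud : DifferentiableAt ℝ (χ ∘ e.symm) (f p) :=
    (contMDiffAt_iff_contDiffAt.1 hu).differentiableAt (by simp)
  refine ⟨hud, ?_⟩
  have hdet := det_smul_add_smulRight (χ p) hχp (fderiv ℝ (χ ∘ e.symm) (f p)).toLinearMap (f p)
  rw [ContinuousLinearMap.coe_coe] at hdet
  rw [← hdet]
  refine detAlong_of_mfderiv_eq_comp _ fun v => ?_
  have h1 : HasFDerivAt (fun z => (χ ∘ e.symm) z • z) _ (f p) :=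
    hud.hasFDerivAt.smul (hasFDerivAt_id (f p))
  have hfd : MDifferentiableAt (𝓡 4) (𝓡 4) f p := by
    have h2 : ContMDiffAt (𝓡 4) (𝓡 4) ∞ e p := contMDiffAt_of_mem_maximalAtlas he hp
    exact (h2.congr_of_eventuallyEq
      (hfe.eventuallyEq_of_mem (e.open_source.mem_nhds hp))).mdifferentiableAt (by simp)
  have h3 : (fun x => χ x • f x) =ᶠ[𝓝 p] (fun z => (χ ∘ e.symm) z • z) ∘ f := by
    filter_upwards [e.open_source.mem_nhds hp] with x hx
    simp [hfe hx, e.left_inv hx]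
  have h4 := mfderiv_comp_apply p h1.differentiableAt.mdifferentiableAt hfd v
  rw [← h3.mfderiv_eq, mfderiv_eq_fderiv, h1.fderiv] at h4
  refine h4.trans ?_
  have h5 : (χ ∘ e.symm) (f p) = χ p := by simp [hfp, e.left_inv hp]
  rw [h5]
  rfl

variable [IsManifold (𝓡 4) ∞ M]

/-- The fibre over `z` is examined on the curve `L` mapped by `f` into the open ray through `z`,
with `s` as local parameter. The factor `D` that determines the sign of the Jacobian of `χ f` is
also the derivative of `s χ` along `L`, so the signed fibre sum is a signed crossing count, which is
zero. -/
theorem hasDegree_zero_of_smul [T2Space M] [CompactSpace M] (o : Orientation4 M) {f : M → R4}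
    {V : Set M} (hV : IsOpen V) (hf : ∀ x ∈ V, ContMDiffAt (𝓡 4) (𝓡 4) ∞ f x)
    (hpos : ∀ x ∈ V, o.Pos (detAlong f x)) {χ : M → ℝ}
    (hχ : ContMDiff (𝓡 4) 𝓘(ℝ, ℝ) ∞ χ) (hχ0 : ∀ x, 0 ≤ χ x) (hsupp : tsupport χ ⊆ V)
    {x₀ : M} (hx₀ : x₀ ∉ tsupport χ) :
    o.HasDegree (centralProj ∘ fun x => χ x • f x) 0 := by
  classical
  set F : M → R4 := fun x => χ x • f x with hFdef
  have hF : ContMDiff (𝓡 4) (𝓡 4) ∞ F := contMDiff_smul_of_tsupport_subset hf hχ hsupp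
  have hFd : ∀ x, MDifferentiableAt (𝓡 4) (𝓡 4) F x := fun x => hF.mdifferentiableAt (by simp)
  constructor
  · obtain ⟨y, hy⟩ := exists_notMem_range_centralProj
    exact ⟨y, fun x hx => absurd hx (hy _)⟩
  intro y hy
  by_cases hyr : ∃ z, centralProj z = y
  swap
  · have : centralProj ∘ F ⁻¹' {y} = ∅ := by
      refine eq_empty_of_forall_notMem fun x hx => hyr ⟨F x, hx⟩
    rw [this, finsum_mem_empty]
  obtain ⟨z, rfl⟩ := hyr
  have hfib : centralProj ∘ F ⁻¹' {centralProj z} = {x | F x = z} := by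
    ext x
    exact centralProj_injective.eq_iff
  rw [hfib]
  -- Near `x₀` the map is constant, so its value there cannot be regular.
  have hz : z ≠ 0 := by
    rintro rfl
    have h1 : F =ᶠ[𝓝 x₀] fun _ => 0 := by
      filter_upwards [(isClosed_tsupport χ).isOpen_compl.mem_nhds hx₀] with x hx
      simp [hFdef, image_eq_zero_of_notMem_tsupport hx]
    have h2 := hy x₀ (by simp [h1.eq_of_nhds])
    have h3 : centralProj ∘ F =ᶠ[𝓝 x₀] fun _ => centralProj 0 := by
      filter_upwards [h1] with x hx
      simp [hx]
    rw [h3.mfderiv_eq, mfderiv_const] at h2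
    obtain ⟨v, hv⟩ := h2 (EuclideanSpace.single 0 1 : R4)
    have h4 : (0 : R4) = EuclideanSpace.single 0 1 := hv
    have h5 := congrArg (fun u : R4 => u 0) h4
    simp at h5
  have hinj : ∀ x, F x = z → detAlong F x ≠ 0 := by
    intro x hx
    refine detAlong_ne_zero_of_injective ?_
    have h1 : Function.Injective (mfderiv (𝓡 4) (𝓡 4) (centralProj ∘ F) x) :=
      (R4.injective_iff_surjective (mfderiv (𝓡 4) (𝓡 4) (centralProj ∘ F) x).toLinearMap).2
        (hy x (by simp [hx]))
    rw [mfderiv_comp x (contMDiff_centralProj.mdifferentiableAt (by simp)) (hFd x)] at h1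
    exact Function.Injective.of_comp h1
  set s : M → ℝ := fun x => inner ℝ (f x) z / ‖z‖ ^ 2 with hs
  have hzn : ‖z‖ ^ 2 ≠ 0 := by simpa using hz
  have hsmul : ∀ (x : M) (t : ℝ), f x = t • z → s x = t := by
    intro x t h
    simp only [hs]
    rw [h, inner_smul_left, real_inner_self_eq_norm_sq]
    field_simp
    simp
  set L : Set M := {x | x ∈ V ∧ 0 < s x ∧ f x = s x • z} with hL
  have hcf : ContinuousOn f V := fun x hx => (hf x hx).continuousAt.continuousWithinAt
  have hcs : ContinuousOn s V := (hcf.inner continuousOn_const).div_const _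
  have hcs' : Continuous fun x : L => s x :=
    continuousOn_iff_continuous_domRestrict.1 (hcs.mono fun x hx => hx.1)
  have hch' : Continuous fun x : L => s x * χ x :=
    hcs'.mul (hχ.continuous.comp continuous_subtype_val)
  -- As `χ ≥ 0`, the bound forces `s > 0`. The open condition in `L` is thus automatic, which makes
  -- the region closed inside `tsupport χ`.
  have hmemL : ∀ x, 1 ≤ s x * χ x → f x = s x • z → x ∈ L ∧ x ∈ tsupport χ := by
    intro x hx hfx
    have h1 : χ x ≠ 0 := by
      intro h
      rw [h] at hx
      norm_num at hx
    have h2 : 0 < χ x := lt_of_le_of_ne (hχ0 x) h1.symm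
    have h3 : x ∈ tsupport χ := subset_tsupport _ h1
    refine ⟨⟨hsupp h3, ?_, hfx⟩, h3⟩
    by_contra h4
    nlinarith
  have hcompact : IsCompact {x : L | 1 ≤ s x * χ x} := by
    rw [Topology.IsEmbedding.subtypeVal.isCompact_iff]
    have h1 : Subtype.val '' {x : L | 1 ≤ s x * χ x} =
        (tsupport χ ∩ (fun x => f x - s x • z) ⁻¹' {0}) ∩
          (tsupport χ ∩ (fun x => s x * χ x) ⁻¹' Ici 1) := by
      ext x
      constructor
      · rintro ⟨⟨x, hx⟩, h1, rfl⟩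
        have h2 := (hmemL x h1 hx.2.2).2
        exact ⟨⟨h2, sub_eq_zero.2 hx.2.2⟩, h2, h1⟩
      · rintro ⟨⟨-, h2⟩, -, h3⟩
        exact ⟨⟨x, (hmemL x h3 (sub_eq_zero.1 h2)).1⟩, h3, rfl⟩
    rw [h1]
    refine (IsClosed.inter ?_ ?_).isCompact
    · exact ((hcf.mono hsupp).sub ((hcs.mono hsupp).smul
        continuousOn_const)).preimage_isClosed_of_isClosed (isClosed_tsupport χ) isClosed_singleton
    · exact ((hcs.mono hsupp).mul
        hχ.continuous.continuousOn).preimage_isClosed_of_isClosed (isClosed_tsupport χ) isClosed_Ici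
  have hchart : ∀ p ∈ V, ∃ e ∈ IsManifold.maximalAtlas (𝓡 4) ∞ M, p ∈ e.source ∧ e.source ⊆ V ∧
      EqOn f e e.source := fun p hp => exists_chart_of_injective_mfderiv hV hf (fun x hx =>
    injective_mfderiv_of_detAlong_ne_zero (by
      intro h
      obtain ⟨b, hb⟩ := o.exists_basis x
      have := hpos x hx b hb
      rw [h] at this
      exact lt_irrefl _ this)) hp
  have hsec : ∀ p : L, 1 ≤ s p * χ p → ∃ c, IsLocalSection (fun x : L => s x) p c := by
    rintro ⟨p, hp⟩ -
    obtain ⟨e, he, hpe, heV, hfe⟩ := hchart p hp.1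
    have hsp : s p • z = e p := by rw [← hfe hpe, ← hp.2.2]
    have htgt : s p • z ∈ e.target := by rw [hsp]; exact e.map_source hpe
    have hline : ContinuousAt (fun t : ℝ => t • z) (s p) := by fun_prop
    have hL' : ∀ᶠ t in 𝓝 (s p), e.symm (t • z) ∈ L ∧ s (e.symm (t • z)) = t := by
      filter_upwards [hline.eventually (e.open_target.mem_nhds htgt), lt_mem_nhds hp.2.1]
        with t h1 h2
      have h3 : f (e.symm (t • z)) = t • z := by rw [hfe (e.map_target h1), e.right_inv h1]
      have h4 := hsmul _ _ h3
      exact ⟨⟨heV (e.map_target h1), h4.symm ▸ h2, by rw [h4, h3]⟩, h4⟩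
    -- The section lifts the ray through the chart `e`; the value `p` is a filler that is never used
    -- for `t` near `s p`.
    refine ⟨fun t => if h : e.symm (t • z) ∈ L then ⟨_, h⟩ else ⟨p, hp⟩, ?_, ?_, ?_, ?_⟩
    · rw [Topology.IsInducing.subtypeVal.continuousAt_iff]
      have h5 : ContinuousAt (fun t : ℝ => e.symm (t • z)) (s p) :=
        ContinuousAt.comp (f := fun t : ℝ => t • z) (e.continuousAt_symm htgt) hline
      refine h5.congr ?_
      filter_upwards [hL'] with t ht
      simp [ht.1]
    · have h6 : e.symm (s p • z) = p := by rw [hsp, e.left_inv hpe]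
      simp [h6]
    · filter_upwards [hL'] with t ht
      simp [ht.1, ht.2]
    · have h7 : ∀ᶠ x : L in 𝓝 ⟨p, hp⟩, (x : M) ∈ e.source :=
        continuous_subtype_val.continuousAt.eventually (e.open_source.mem_nhds hpe)
      filter_upwards [h7] with x hx
      have h8 : e.symm (s x • z) = x := by rw [← x.2.2.2, hfe hx, e.left_inv hx]
      simp [h8]
  have hsg : ∀ p : L, s p * χ p = 1 →
      (o.sign (pullbackVolume (centralProj ∘ F) (p : M)) = 1 ∧ ∀ᶠ x : L in 𝓝 p,
        (s p < s x → 1 < s x * χ x) ∧ (s x < s p → s x * χ x < 1)) ∨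
      (o.sign (pullbackVolume (centralProj ∘ F) (p : M)) = -1 ∧ ∀ᶠ x : L in 𝓝 p,
        (s p < s x → s x * χ x < 1) ∧ (s x < s p → 1 < s x * χ x)) := by
    rintro ⟨p, hp⟩ (h1 : s p * χ p = 1)
    obtain ⟨e, he, hpe, heV, hfe⟩ := hchart p hp.1
    have hχp : χ p ≠ 0 := right_ne_zero_of_mul_eq_one h1
    have hχp' : 0 < χ p := lt_of_le_of_ne (hχ0 p) hχp.symm
    obtain ⟨hd, hdet⟩ := detAlong_smul hχ he hfe hpe hχp
    have hFp : F p = z := by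
      simp only [hFdef]
      rw [hp.2.2, smul_smul, mul_comm, h1, one_smul]
    set D := χ p + fderiv ℝ (χ ∘ e.symm) (f p) (f p) with hD
    have hD0 : D ≠ 0 := by
      intro h
      refine hinj p hFp ?_
      rw [hFdef, hdet, h, mul_zero, zero_smul]
    rw [pullbackVolume_centralProj_comp (hFd p), hFdef, hdet, smul_smul]
    have hκ : 0 < 3 / (8 * Real.pi ^ 2) * projScale (F p) ^ 5 * χ p ^ 3 := by
      have := projScale_pos (F p)
      have := Real.pi_pos
      positivity
    -- Since `f p = s p • z`, the product rule gives `χ p` plus the derivative of `χ ∘ e.symm` in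
    -- the direction `f p`, which is `D`.
    have hderiv : HasDerivAt (fun t : ℝ => t * (χ ∘ e.symm) (t • z)) D (s p) := by
      have h2 : HasDerivAt (fun t : ℝ => t • z) z (s p) := by
        simpa using (hasDerivAt_id (s p)).smul_const z
      have h3 : HasFDerivAt (χ ∘ e.symm) (fderiv ℝ (χ ∘ e.symm) (f p)) (s p • z) := by
        rw [← hp.2.2]; exact hd.hasFDerivAt
      have h4 := (hasDerivAt_id (s p)).mul (h3.comp_hasDerivAt (s p) h2)
      refine h4.congr_deriv ?_
      have h5 : (χ ∘ e.symm) (s p • z) = χ p := by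
        rw [← hp.2.2, hfe hpe]; simp [e.left_inv hpe]
      simp only [Function.comp_apply] at h5
      have h6 : ∀ l : R4 →L[ℝ] ℝ, l (f p) = s p * l z := fun l => by
        rw [hp.2.2, map_smul, smul_eq_mul]
      rw [hD, h6]
      simp [h5]
    have hval : ∀ᶠ x : L in 𝓝 ⟨p, hp⟩, s x * (χ ∘ e.symm) (s x • z) = s x * χ x := by
      have h7 : ∀ᶠ x : L in 𝓝 ⟨p, hp⟩, (x : M) ∈ e.source :=
        continuous_subtype_val.continuousAt.eventually (e.open_source.mem_nhds hpe)
      filter_upwards [h7] with x hx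
      rw [← x.2.2.2, hfe hx]
      simp [e.left_inv hx]
    have hval' : s p * (χ ∘ e.symm) (s p • z) = 1 := hval.self_of_nhds.trans h1
    have hst : Tendsto (fun x : L => s x) (𝓝 ⟨p, hp⟩) (𝓝 (s p)) := hcs'.continuousAt
    rcases lt_or_gt_of_ne hD0 with hneg | hposD
    · right
      refine ⟨Orientation4.sign_smul_of_neg (hpos p hp.1) ?_, ?_⟩
      · have := mul_neg_of_pos_of_neg hκ hneg
        linarith
      · filter_upwards [hval, hst.eventually (eventually_crossing_of_hasDerivAt_neg hderiv hneg)]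
          with x h8 h9
        simp only [hval', h8] at h9
        exact h9
    · left
      refine ⟨Orientation4.sign_smul_of_pos (hpos p hp.1) ?_, ?_⟩
      · have := mul_pos hκ hposD
        linarith
      · filter_upwards [hval, hst.eventually (eventually_crossing_of_hasDerivAt_pos hderiv hposD)]
          with x h8 h9
        simp only [hval', h8] at h9
        exact h9
  have key := finsum_crossing_eq_zero hcs' hch' hcompact hsec
    (fun x : L => o.sign (pullbackVolume (centralProj ∘ F) (x : M))) hsg
  have himg : {x | F x = z} = Subtype.val '' {x : L | s x * χ x = 1} := by
    ext x
    constructor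
    · intro (hx : χ x • f x = z)
      have h1 : χ x ≠ 0 := by
        rintro h
        rw [h, zero_smul] at hx
        exact hz hx.symm
      have h2 : f x = (χ x)⁻¹ • z := by rw [← hx, smul_smul, inv_mul_cancel₀ h1, one_smul]
      have h3 := hsmul _ _ h2
      have h4 : s x * χ x = 1 := by rw [h3, inv_mul_cancel₀ h1]
      exact ⟨⟨x, (hmemL x h4.ge (by rw [h3]; exact h2)).1⟩, h4, rfl⟩
    · rintro ⟨⟨x, hx⟩, h1, rfl⟩
      change χ x • f x = z
      rw [hx.2.2, smul_smul, mul_comm]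
      rw [show s x * χ x = 1 from h1, one_smul]
  rw [himg, finsum_mem_image Subtype.val_injective.injOn]
  exact key

end Degree

/-! ### Constructing the complementary map from an immersion -/

section Extension

variable {M : Type*} [TopologicalSpace M] [ChartedSpace R4 M]

theorem detAlong_comp_clm {F : M → R4} {x : M} (hF : MDifferentiableAt (𝓡 4) (𝓡 4) F x)
    (A : R4 →L[ℝ] R4) :
    detAlong (fun y => A (F y)) x = LinearMap.det A.toLinearMap • detAlong F x := by
  refine detAlong_of_mfderiv_eq_comp _ fun v => ?_
  have h := mfderiv_comp_apply x (A.contDiff.contMDiff (n := 1) (F x) |>.mdifferentiableAt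
    one_ne_zero) hF v
  rw [mfderiv_eq_fderiv, A.fderiv] at h
  exact h

theorem detAlong_const_smul {F : M → R4} {x : M} (hF : MDifferentiableAt (𝓡 4) (𝓡 4) F x)
    (ε : ℝ) : detAlong (fun y => ε • F y) x = ε ^ 4 • detAlong F x := by
  have h := detAlong_comp_clm hF (ε • ContinuousLinearMap.id ℝ R4)
  have h1 : LinearMap.det (ε • ContinuousLinearMap.id ℝ R4).toLinearMap = ε ^ 4 := by
    have h2 : (ε • ContinuousLinearMap.id ℝ R4).toLinearMap = ε • LinearMap.id := rfl
    rw [h2, LinearMap.det_smul]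
    simp
  rw [h1] at h
  exact h

theorem exists_clm_det_neg : ∃ A : R4 →L[ℝ] R4, LinearMap.det A.toLinearMap < 0 := by
  -- The reflection `v ↦ v - 2 v₀ e₀`, of determinant `1 - 2`.
  have h := det_smul_add_smulRight 1 one_ne_zero
    (EuclideanSpace.proj (0 : Fin 4) : R4 →L[ℝ] ℝ).toLinearMap (EuclideanSpace.single 0 (-2))
  refine ⟨LinearMap.toContinuousLinearMap ((1 : ℝ) • LinearMap.id +
    (EuclideanSpace.proj (0 : Fin 4) : R4 →L[ℝ] ℝ).toLinearMap.smulRight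
      (EuclideanSpace.single 0 (-2))), ?_⟩
  rw [LinearMap.coe_toContinuousLinearMap, h]
  simp

theorem detAlong_congr {F G : M → R4} {x : M} (h : F =ᶠ[𝓝 x] G) :
    detAlong F x = detAlong G x := by
  simp only [detAlong, h.mfderiv_eq]

theorem exists_extension_of_isImmersion {V : TopologicalSpace.Opens M} {f : V → R4}
    (hf : Manifold.IsImmersion (𝓡 4) (𝓡 4) ∞ f) :
    ∃ g : M → R4, ∀ x ∈ V, ContMDiffAt (𝓡 4) (𝓡 4) ∞ g x ∧ detAlong g x ≠ 0 := by
  classical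
  set g : M → R4 := fun x => if h : x ∈ V then f ⟨x, h⟩ else 0 with hg
  have hgf : (fun x : V => g x) = f := by
    funext x
    simp [hg]
  refine ⟨g, fun x hx => ?_⟩
  have hc : ContMDiffAt (𝓡 4) (𝓡 4) ∞ g x := by
    have h1 : ContMDiffAt (𝓡 4) (𝓡 4) ∞ (fun x : V => g x) ⟨x, hx⟩ := by
      rw [hgf]; exact hf.contMDiff _
    exact contMDiffAt_subtype_iff.1 h1
  refine ⟨hc, detAlong_ne_zero_of_injective ?_⟩
  have h2 := injective_mfderiv_of_isImmersionAt (hf.isImmersionAt ⟨x, hx⟩)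
  have h3 : mfderiv (𝓡 4) (𝓡 4) f ⟨x, hx⟩ =
      (mfderiv (𝓡 4) (𝓡 4) g x).comp (mfderiv (𝓡 4) (𝓡 4) (Subtype.val : V → M) ⟨x, hx⟩) := by
    rw [← hgf]
    exact mfderiv_comp (I' := 𝓡 4) (⟨x, hx⟩ : V) (hc.mdifferentiableAt (by simp))
      ((contMDiff_subtype_val (n := ∞) _).mdifferentiableAt (by simp))
  have h4 : Function.Surjective (mfderiv (𝓡 4) (𝓡 4) f ⟨x, hx⟩) :=
    (R4.injective_iff_surjective (mfderiv (𝓡 4) (𝓡 4) f ⟨x, hx⟩).toLinearMap).1 h2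
  rw [h3] at h4
  exact (R4.injective_iff_surjective (mfderiv (𝓡 4) (𝓡 4) g x).toLinearMap).2
    (Function.Surjective.of_comp h4)

variable [IsManifold (𝓡 4) ∞ M] (o : Orientation4 M)

namespace Orientation4

variable {o} {x : M}

theorem Pos.ne_zero {η : TopForm4 x} (h : o.Pos η) : η ≠ 0 := by
  rintro rfl
  obtain ⟨b, hb⟩ := o.exists_basis x
  exact lt_irrefl _ (h b hb)

theorem Nonneg.add_pos {η ζ : TopForm4 x} (h : o.Nonneg η) (h' : o.Pos ζ) : o.Pos (η + ζ) := by
  intro b hb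
  rw [AlternatingMap.add_apply]
  exact add_pos_of_nonneg_of_pos (h b hb) (h' b hb)

theorem Nonneg.pos {η : TopForm4 x} (h : o.Nonneg η) (h0 : η ≠ 0) : o.Pos η := by
  intro b hb
  exact lt_of_le_of_ne (h b hb) (Ne.symm ((topForm_eq_zero_iff η b).not.1 h0))

end Orientation4

theorem isOpen_setOf_pos_pullbackVolume {φ : M → S4} (hφ : ContMDiff (𝓡 4) (𝓡 4) ∞ φ) :
    IsOpen {x | o.Pos (pullbackVolume φ x)} := by
  rw [isOpen_iff_mem_nhds]
  intro x hx
  exact o.eventually_pos (fun b₀ => continuousAt_pullbackVolume hφ b₀) hx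

theorem isOpen_setOf_pos_neg_pullbackVolume {φ : M → S4} (hφ : ContMDiff (𝓡 4) (𝓡 4) ∞ φ) :
    IsOpen {x | o.Pos (-pullbackVolume φ x)} := by
  rw [isOpen_iff_mem_nhds]
  intro x hx
  exact o.eventually_pos (η := fun x => -pullbackVolume φ x)
    (fun b₀ => (continuousAt_pullbackVolume hφ b₀).neg) hx

theorem isClosed_zeroLocus (o : Orientation4 M) {φ : M → S4} (hφ : ContMDiff (𝓡 4) (𝓡 4) ∞ φ) :
    IsClosed (zeroLocus φ) := by
  have h : (zeroLocus φ)ᶜ = {x | o.Pos (pullbackVolume φ x)} ∪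
      {x | o.Pos (-pullbackVolume φ x)} := by
    ext x
    constructor
    · exact fun hx => o.pos_or_pos_neg hx
    · rintro (hx | hx) h0
      · exact hx.ne_zero h0
      · exact hx.ne_zero (neg_eq_zero.2 h0)
  rw [← isOpen_compl_iff, h]
  exact (isOpen_setOf_pos_pullbackVolume o hφ).union (isOpen_setOf_pos_neg_pullbackVolume o hφ)

/-- The sign of the Jacobian is locally constant on `V`, so switching pointwise between `f` and its
composite with a map of negative determinant does not spoil smoothness. -/
theorem exists_orientation_preserving {V : TopologicalSpace.Opens M} {f : M → R4}
    (hf : ∀ x ∈ V, ContMDiffAt (𝓡 4) (𝓡 4) ∞ f x ∧ detAlong f x ≠ 0) :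
    ∃ g : M → R4, ∀ x ∈ V, ContMDiffAt (𝓡 4) (𝓡 4) ∞ g x ∧ o.Pos (detAlong g x) := by
  classical
  obtain ⟨A, hA⟩ := exists_clm_det_neg
  refine ⟨fun x => if o.Pos (detAlong f x) then f x else A (f x), fun x hx => ?_⟩
  have hev : ∀ᶠ y in 𝓝 x, ContMDiffAt (𝓡 4) (𝓡 4) ∞ f y := by
    filter_upwards [V.isOpen.mem_nhds hx] with y hy using (hf y hy).1
  rcases o.pos_or_pos_neg (hf x hx).2 with hpos | hneg
  · have h1 : (fun x => if o.Pos (detAlong f x) then f x else A (f x)) =ᶠ[𝓝 x] f := by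
      filter_upwards [o.eventually_pos (fun b₀ => continuousAt_detAlong hev b₀) hpos] with y hy
      rw [if_pos hy]
    refine ⟨(hf x hx).1.congr_of_eventuallyEq h1, ?_⟩
    have h2 : detAlong (fun x => if o.Pos (detAlong f x) then f x else A (f x)) x =
        detAlong f x := detAlong_congr h1
    rw [h2]
    exact hpos
  · have h1 : (fun x => if o.Pos (detAlong f x) then f x else A (f x)) =ᶠ[𝓝 x]
        fun y => A (f y) := by
      filter_upwards [o.eventually_pos (η := fun x => -detAlong f x)
        (fun b₀ => (continuousAt_detAlong hev b₀).neg) hneg] with y hy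
      have h2 := o.not_pos_neg hy
      rw [neg_neg] at h2
      rw [if_neg h2]
    have hd : MDifferentiableAt (𝓡 4) (𝓡 4) f x := (hf x hx).1.mdifferentiableAt (by simp)
    refine ⟨((A.contDiff.contMDiff (n := ∞) (f x)).comp x (hf x hx).1).congr_of_eventuallyEq h1,
      ?_⟩
    have h2 : detAlong (fun x => if o.Pos (detAlong f x) then f x else A (f x)) x =
        detAlong (fun y => A (f y)) x := detAlong_congr h1
    rw [h2, detAlong_comp_clm hd]
    have h3 := hneg.smul (neg_pos.2 hA)
    intro b hb
    have h4 := h3 b hb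
    simpa using h4

/-- In a local positive frame the first form is bounded below by a positive constant and the second
is bounded; compactness makes the resulting threshold uniform. -/
theorem exists_uniform_pos {φ : M → S4} (hφ : ContMDiff (𝓡 4) (𝓡 4) ∞ φ) {F : M → R4}
    (hF : ContMDiff (𝓡 4) (𝓡 4) ∞ F) {C : Set M} (hC : IsCompact C)
    (hpos : ∀ x ∈ C, o.Pos (pullbackVolume φ x)) :
    ∃ δ > 0, ∀ x ∈ C, ∀ κ : ℝ, 0 < κ → κ ≤ δ →
      o.Pos (pullbackVolume φ x + κ • detAlong F x) := by
  refine hC.induction_on (p := fun C => ∃ δ > 0, ∀ x ∈ C, ∀ κ : ℝ, 0 < κ → κ ≤ δ →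
      o.Pos (pullbackVolume φ x + κ • detAlong F x)) ⟨1, one_pos, fun x hx => hx.elim⟩ ?_ ?_ ?_
  · rintro s t hst ⟨δ, hδ, h⟩
    exact ⟨δ, hδ, fun x hx => h x (hst hx)⟩
  · rintro s t ⟨δ, hδ, h⟩ ⟨δ', hδ', h'⟩
    refine ⟨min δ δ', lt_min hδ hδ', ?_⟩
    rintro x (hx | hx) κ hκ hκδ
    · exact h x hx κ hκ (hκδ.trans (min_le_left _ _))
    · exact h' x hx κ hκ (hκδ.trans (min_le_right _ _))
  · intro x hx
    obtain ⟨b₀, hb₀⟩ := o.exists_frame x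
    obtain ⟨b, hb, hbe⟩ := hb₀.self_of_nhds
    have hp := continuousAt_pullbackVolume (x₀ := x) hφ b₀
    have hq := continuousAt_detAlong (x₀ := x) (Eventually.of_forall fun y => hF y) b₀
    have h1 := hpos x hx b hb
    rw [show (b : Fin 4 → T4 x) = _ from funext hbe] at h1
    set p : M → ℝ := fun y => pullbackVolume φ y fun i =>
      (trivializationAt R4 (TangentSpace (𝓡 4) : M → Type) x).symmL ℝ y (b₀ i) with hpdef
    set q : M → ℝ := fun y => detAlong F y fun i =>
      (trivializationAt R4 (TangentSpace (𝓡 4) : M → Type) x).symmL ℝ y (b₀ i) with hqdef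
    have h1' : 0 < p x := h1
    set δ := p x / 2 / (|q x| + 1) with hδdef
    have hQ : 0 < |q x| + 1 := by positivity
    have hδ : 0 < δ := by positivity
    have h2 := hp.eventually (lt_mem_nhds (show p x / 2 < p x by linarith))
    have h3 := hq.abs.eventually (gt_mem_nhds (show |q x| < |q x| + 1 by linarith))
    refine ⟨_, mem_nhdsWithin_of_mem_nhds (h2.and (h3.and hb₀)), δ, hδ, ?_⟩
    rintro y ⟨h4, h5, b', hb', hbe'⟩ κ hκ hκδ
    rw [Orientation4.pos_iff hb', AlternatingMap.add_apply, AlternatingMap.smul_apply, smul_eq_mul,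
      show (b' : Fin 4 → T4 y) = _ from funext hbe']
    change 0 < p y + κ * q y
    have h4' : p x / 2 < p y := h4
    have h5' : |q y| < |q x| + 1 := h5
    have h6 : κ * |q y| ≤ δ * (|q x| + 1) := by gcongr
    have h7 : δ * (|q x| + 1) = p x / 2 := by rw [hδdef]; field_simp
    have h8 : -(κ * |q y|) ≤ κ * q y := by
      rw [← mul_neg]
      exact mul_le_mul_of_nonneg_left (neg_abs_le _) hκ.le
    linarith

theorem exists_complementary_map [T2Space M] [CompactSpace M]
    {φ : M → S4} (hφ : ContMDiff (𝓡 4) (𝓡 4) ∞ φ)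
    (hnonneg : ∀ x : M, o.Nonneg (pullbackVolume φ x)) (hnonzero : ∃ x : M, pullbackVolume φ x ≠ 0)
    (himm : HasImmersedNeighborhood (zeroLocus φ)) :
    ∃ φ' : M → S4, ContMDiff (𝓡 4) (𝓡 4) ∞ φ' ∧
      (∀ x : M, pullbackVolume φ x + pullbackVolume φ' x ≠ 0) ∧ o.HasDegree φ' 0 := by
  obtain ⟨V, hRV, f₀, hf₀⟩ := himm
  obtain ⟨f₁, hf₁⟩ := exists_extension_of_isImmersion hf₀
  obtain ⟨f, hf⟩ := exists_orientation_preserving o hf₁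
  obtain ⟨x₀, hx₀⟩ := hnonzero
  have hR := isClosed_zeroLocus o hφ
  -- The point `x₀` is removed so that the cut-off map vanishes near it, as the degree computation
  -- requires.
  obtain ⟨U₁, hU₁, hRU₁, hU₁V⟩ := normal_exists_closure_subset hR
    (V.isOpen.inter (isOpen_compl_singleton (x := x₀)))
    (fun x hx => ⟨hRV hx, by rintro rfl; exact hx₀ hx⟩)
  obtain ⟨U₂, hU₂, hRU₂, hU₂U₁⟩ := normal_exists_closure_subset hR hU₁ hRU₁
  obtain ⟨χ, hχ, hχr, hχ0, hχ1⟩ := exists_contMDiff_zero_iff_one_iff_of_isClosed (n := ⊤) (𝓡 4)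
    hU₁.isClosed_compl (isClosed_closure (s := U₂)) (disjoint_compl_left_iff_subset.2 hU₂U₁)
  have hχnn : ∀ x, 0 ≤ χ x := fun x => (hχr (mem_range_self x)).1
  have hts : tsupport χ ⊆ closure U₁ := closure_mono fun x hx => by
    by_contra h
    exact hx ((hχ0 x).1 h)
  have hsupp : tsupport χ ⊆ V := fun x hx => (hU₁V (hts hx)).1
  have hx₀s : x₀ ∉ tsupport χ := fun hx => (hU₁V (hts hx)).2 rfl
  have hF₁ : ContMDiff (𝓡 4) (𝓡 4) ∞ fun x => χ x • f x :=
    contMDiff_smul_of_tsupport_subset (fun x hx => (hf x hx).1) hχ hsupp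
  obtain ⟨δ, hδ, hδpos⟩ := exists_uniform_pos o hφ hF₁ hU₂.isClosed_compl.isCompact
    (fun x hx => (hnonneg x).pos fun h => hx (hRU₂ h))
  set c : ℝ := 3 / (8 * Real.pi ^ 2) with hc
  have hcpos : 0 < c := by have := Real.pi_pos; positivity
  -- The threshold `δ` was found for the unscaled map. Scaling by `ε` multiplies the Jacobian by `ε
  -- ^ 4`, and `c * k ^ 5 * ε ^ 4 ≤ c * ε ≤ δ` because `k` and `ε` are at most `1`.
  set ε : ℝ := min 1 (δ / c) with hε
  have hεpos : 0 < ε := lt_min one_pos (by positivity)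
  have hε1 : ε ≤ 1 := min_le_left _ _
  have hεδ : c * ε ≤ δ := by
    have : ε ≤ δ / c := min_le_right _ _
    rwa [le_div_iff₀ hcpos, mul_comm] at this
  have hfε : ∀ x ∈ V, ContMDiffAt (𝓡 4) (𝓡 4) ∞ (fun y => ε • f y) x ∧
      o.Pos (detAlong (fun y => ε • f y) x) := by
    intro x hx
    refine ⟨(contMDiffAt_const (I := 𝓡 4) (I' := 𝓘(ℝ, ℝ)) (c := ε)).smul (hf x hx).1, ?_⟩
    rw [detAlong_const_smul ((hf x hx).1.mdifferentiableAt (by simp))]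
    exact (hf x hx).2.smul (by positivity)
  have hFs : ContMDiff (𝓡 4) (𝓡 4) ∞ fun x => χ x • ε • f x :=
    contMDiff_smul_of_tsupport_subset (fun x hx => (hfε x hx).1) hχ hsupp
  refine ⟨centralProj ∘ fun x => χ x • ε • f x, contMDiff_centralProj.comp hFs, fun x => ?_,
    hasDegree_zero_of_smul o V.isOpen (fun x hx => (hfε x hx).1) (fun x hx => (hfε x hx).2)
      hχ hχnn hsupp hx₀s⟩
  refine Orientation4.Pos.ne_zero (o := o) ?_
  rw [pullbackVolume_centralProj_comp (hFs.mdifferentiableAt (by simp))]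
  have h1 : (fun x => χ x • ε • f x) = fun x => ε • χ x • f x := by
    funext y; rw [smul_comm]
  rw [h1, detAlong_const_smul (hF₁.mdifferentiableAt (by simp)), smul_smul, ← hc]
  set k := projScale (χ x • ε • f x) with hk
  have hk0 : 0 < k := projScale_pos _
  have hk1 : k ≤ 1 := projScale_le_one _
  have hκ : 0 < c * k ^ 5 * ε ^ 4 := by positivity
  by_cases hx : x ∈ U₂
  · have h2 : (fun y => χ y • f y) =ᶠ[𝓝 x] f := by
      filter_upwards [hU₂.mem_nhds hx] with y hy
      rw [(hχ1 y).1 (subset_closure hy), one_smul]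
    have h3 : detAlong (fun y => χ y • f y) x = detAlong f x := detAlong_congr h2
    rw [h3]
    have hxV : x ∈ V := (hU₁V (subset_closure (hU₂U₁ (subset_closure hx)))).1
    exact (hnonneg x).add_pos ((hf x hxV).2.smul hκ)
  · refine hδpos x hx _ hκ (le_trans ?_ hεδ)
    have h4 : k ^ 5 ≤ 1 := pow_le_one₀ hk0.le hk1
    have h5 : ε ^ 4 ≤ ε := pow_le_of_le_one hεpos.le hε1 (by norm_num)
    calc c * k ^ 5 * ε ^ 4 ≤ c * 1 * ε := by gcongr
      _ = c * ε := by ring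

end Extension

/-! ### Moving points by self-immersions with prescribed support -/

section Push

/-- Translation by `v` cut off by the function `b`. -/
def cutoffTranslation (b : R4 → ℝ) (v z : R4) : R4 := z + b z • v

/-- The displacement `b z • v` is a contraction in `z`, so it cannot cancel a nonzero difference `z
- w`. -/
theorem cutoffTranslation_injective {b : R4 → ℝ} {K : NNReal} (hb : LipschitzWith K b) {v : R4}
    (hv : K * ‖v‖ < 1) : Function.Injective (cutoffTranslation b v) := by
  intro z w h
  have h1 : z - w = (b w - b z) • v := by
    rw [sub_smul, sub_eq_sub_iff_add_eq_add]
    have h2 : z + b z • v = w + b w • v := h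
    rw [h2, add_comm]
  have h2 : ‖z - w‖ ≤ K * ‖v‖ * ‖z - w‖ := by
    calc ‖z - w‖ = ‖b w - b z‖ * ‖v‖ := by conv_lhs => rw [h1, norm_smul]
      _ ≤ (K * ‖w - z‖) * ‖v‖ := by gcongr; exact hb.norm_sub_le w z
      _ = K * ‖v‖ * ‖z - w‖ := by rw [norm_sub_rev w z]; ring
  by_contra hne
  have h3 : 0 < ‖z - w‖ := norm_pos_iff.2 (sub_ne_zero.2 hne)
  nlinarith

theorem contDiff_cutoffTranslation {b : R4 → ℝ} (hb : ContDiff ℝ ∞ b) (v : R4) :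
    ContDiff ℝ ∞ (cutoffTranslation b v) :=
  contDiff_id.add (hb.smul contDiff_const)

theorem injective_fderiv_cutoffTranslation {b : R4 → ℝ} (hbs : ContDiff ℝ ∞ b) {K : NNReal}
    (hb : LipschitzWith K b) {v : R4} (hv : K * ‖v‖ < 1) (z : R4) :
    Function.Injective (fderiv ℝ (cutoffTranslation b v) z) := by
  have h1 : HasFDerivAt (cutoffTranslation b v)
      (ContinuousLinearMap.id ℝ R4 + (fderiv ℝ b z).smulRight v) z :=
    (hasFDerivAt_id z).add
      ((hbs.contDiffAt.differentiableAt (by simp)).hasFDerivAt.smul_const v)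
  rw [h1.fderiv, injective_iff_map_eq_zero]
  intro w hw
  have h2 : w = -(fderiv ℝ b z w • v) := by
    rw [eq_neg_iff_add_eq_zero]
    simpa using hw
  have h3 : ‖w‖ ≤ K * ‖v‖ * ‖w‖ := by
    calc ‖w‖ = ‖fderiv ℝ b z w‖ * ‖v‖ := by conv_lhs => rw [h2, norm_neg, norm_smul]
      _ ≤ (K * ‖w‖) * ‖v‖ := by
        gcongr
        exact (fderiv ℝ b z).le_of_opNorm_le (norm_fderiv_le_of_lipschitz ℝ hb) w
      _ = K * ‖v‖ * ‖w‖ := by ring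
  by_contra hne
  have h4 : 0 < ‖w‖ := norm_pos_iff.2 hne
  nlinarith

variable {M : Type*} [TopologicalSpace M] [ChartedSpace R4 M]

/-- A smooth injective immersion of `M` into itself which is the identity outside `W`. -/
structure IsPush (W : Set M) (g : M → M) : Prop where
  injective : Function.Injective g
  contMDiff : ContMDiff (𝓡 4) (𝓡 4) ∞ g
  injective_mfderiv : ∀ x, Function.Injective (mfderiv (𝓡 4) (𝓡 4) g x)
  eq_self : ∀ x, x ∉ W → g x = x

theorem IsPush.id (W : Set M) : IsPush W (id : M → M) :=
  ⟨Function.injective_id, contMDiff_id, fun x => by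
    rw [mfderiv_id]; exact Function.injective_id, fun _ _ => rfl⟩

theorem IsPush.comp {W : Set M} {g h : M → M} (hg : IsPush W g) (hh : IsPush W h) :
    IsPush W (g ∘ h) := by
  refine ⟨hg.injective.comp hh.injective, hg.contMDiff.comp hh.contMDiff, fun x => ?_,
    fun x hx => ?_⟩
  · rw [mfderiv_comp x (hg.contMDiff.mdifferentiableAt (by simp))
      (hh.contMDiff.mdifferentiableAt (by simp))]
    exact (hg.injective_mfderiv _).comp (hh.injective_mfderiv x)
  · rw [Function.comp_apply, hh.eq_self x hx, hg.eq_self x hx]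

theorem IsPush.mono {W W' : Set M} {g : M → M} (hg : IsPush W g) (h : W ⊆ W') : IsPush W' g :=
  ⟨hg.injective, hg.contMDiff, hg.injective_mfderiv, fun x hx => hg.eq_self x fun h' => hx (h h')⟩

theorem IsPush.mem {W : Set M} {g : M → M} (hg : IsPush W g) {x : M} (hx : x ∈ W) : g x ∈ W := by
  by_contra h
  rw [hg.injective (hg.eq_self _ h)] at h
  exact h hx

variable [IsManifold (𝓡 4) ∞ M] [T2Space M]

open Classical in
theorem isPush_chart (c : M) {a : R4} {r : ℝ} {W : Set M}
    (hball : Metric.closedBall a r ⊆ (chartAt R4 c).target)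
    (hW : ∀ z ∈ Metric.closedBall a r, (chartAt R4 c).symm z ∈ W) {b : R4 → ℝ}
    (hbs : ContDiff ℝ ∞ b) {K : NNReal} (hb : LipschitzWith K b)
    (hb0 : ∀ z, z ∉ Metric.closedBall a r → b z = 0) {v : R4} (hv : K * ‖v‖ < 1) :
    IsPush W fun y => if y ∈ (chartAt R4 c).source then
      (chartAt R4 c).symm (cutoffTranslation b v (chartAt R4 c y)) else y := by
  have : IsManifold (𝓡 4) 1 M := IsManifold.of_le (n := ∞) (by simp)
  set e := chartAt R4 c with he
  set H := cutoffTranslation b v with hH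
  have hHinj : Function.Injective H := cutoffTranslation_injective hb hv
  have hHid : ∀ z, z ∉ Metric.closedBall a r → H z = z := fun z hz => by
    simp [hH, cutoffTranslation, hb0 z hz]
  -- If `H z` lies outside the ball, then `H` fixes it, and injectivity gives `H z = z`.
  have hHt : ∀ z ∈ e.target, H z ∈ e.target := by
    intro z hz
    by_cases h1 : H z ∈ Metric.closedBall a r
    · exact hball h1
    · rw [hHinj (hHid _ h1)]
      exact hz
  set g : M → M := fun y => if y ∈ e.source then e.symm (H (e y)) else y with hg
  have hgs : ∀ y ∈ e.source, g y = e.symm (H (e y)) := fun y hy => if_pos hy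
  have hgn : ∀ y, y ∉ e.source → g y = y := fun y hy => if_neg hy
  set K₀ := e.symm '' Metric.closedBall a r with hK₀
  have hK₀c : IsClosed K₀ :=
    ((isCompact_closedBall a r).image_of_continuousOn (e.continuousOn_symm.mono hball)).isClosed
  have hgK : ∀ y, y ∉ K₀ → g y = y := by
    intro y hy
    by_cases hys : y ∈ e.source
    · rw [hgs y hys, hHid, e.left_inv hys]
      exact fun h => hy ⟨e y, h, e.left_inv hys⟩
    · exact hgn y hys
  have hcases : ∀ y, y ∈ e.source ∨ y ∉ K₀ := by
    intro y
    by_cases hys : y ∈ e.source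
    · exact Or.inl hys
    · right
      rintro ⟨z, hz, rfl⟩
      exact hys (e.map_target (hball hz))
  have hloc : ∀ y ∈ e.source, g =ᶠ[𝓝 y] e.symm ∘ H ∘ e := fun y hy => by
    filter_upwards [e.open_source.mem_nhds hy] with x hx using hgs x hx
  have hloc' : ∀ y, y ∉ K₀ → g =ᶠ[𝓝 y] id := fun y hy => by
    filter_upwards [hK₀c.isOpen_compl.mem_nhds hy] with x hx using hgK x hx
  have heA : e ∈ IsManifold.maximalAtlas (𝓡 4) ∞ M := IsManifold.chart_mem_maximalAtlas c
  have hHs : ContMDiff (𝓡 4) (𝓡 4) ∞ H := (contDiff_cutoffTranslation hbs v).contMDiff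
  have hHe : ∀ y ∈ e.source, ContMDiffAt (𝓡 4) (𝓡 4) ∞ (H ∘ e) y := fun y hy =>
    (hHs _).comp y (contMDiffAt_of_mem_maximalAtlas heA hy)
  have hsymm : ∀ y ∈ e.source, ContMDiffAt (𝓡 4) (𝓡 4) ∞ e.symm (H (e y)) := fun y hy =>
    contMDiffAt_symm_of_mem_maximalAtlas heA (hHt _ (e.map_source hy))
  refine ⟨?_, ?_, ?_, ?_⟩
  · intro y y' h
    have h' : g y = g y' := h
    have hm : ∀ y ∈ e.source, g y ∈ e.source := fun y hy => by
      rw [hgs y hy]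
      exact e.map_target (hHt _ (e.map_source hy))
    by_cases hy : y ∈ e.source <;> by_cases hy' : y' ∈ e.source
    · rw [hgs y hy, hgs y' hy'] at h'
      exact e.injOn hy hy' (hHinj (e.symm.injOn (hHt _ (e.map_source hy))
        (hHt _ (e.map_source hy')) h'))
    · have h1 := hm y hy
      rw [h', hgn y' hy'] at h1
      exact absurd h1 hy'
    · have h1 := hm y' hy'
      rw [← h', hgn y hy] at h1
      exact absurd h1 hy
    · rwa [hgn y hy, hgn y' hy'] at h'
  · intro y
    rcases hcases y with hy | hy
    · exact ((hsymm y hy).comp y (hHe y hy)).congr_of_eventuallyEq (hloc y hy)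
    · exact contMDiffAt_id.congr_of_eventuallyEq (hloc' y hy)
  · intro y
    rcases hcases y with hy | hy
    · rw [(hloc y hy).mfderiv_eq, mfderiv_comp (I' := 𝓡 4) y
        ((hsymm y hy).mdifferentiableAt (by simp)) ((hHe y hy).mdifferentiableAt (by simp)),
        mfderiv_comp (I' := 𝓡 4) y (hHs.mdifferentiableAt (by simp))
          ((contMDiffAt_of_mem_maximalAtlas heA hy).mdifferentiableAt (by simp)),
        mfderiv_eq_fderiv]
      exact ((mdifferentiable_chart (I := 𝓡 4) c).symm.mfderiv_injective
        (hHt _ (e.map_source hy))).comp ((injective_fderiv_cutoffTranslation hbs hb hv _).comp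
          ((mdifferentiable_chart (I := 𝓡 4) c).mfderiv_injective hy))
    · rw [(hloc' y hy).mfderiv_eq, mfderiv_id]
      exact Function.injective_id
  · intro y hy
    refine hgK y ?_
    rintro ⟨z, hz, rfl⟩
    exact hy (hW z hz)

/-- Where the bump equals `1`, the push is a genuine translation in the chart. Pushes are not known
to have inverses that are pushes, so both directions are recorded; opposite translation vectors
provide them. -/
theorem eventually_exists_isPush {W : Set M} (hW : IsOpen W) {x : M} (hx : x ∈ W) :
    ∀ᶠ y in 𝓝 x, (∃ g, IsPush W g ∧ g x = y) ∧ ∃ g, IsPush W g ∧ g y = x := by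
  classical
  set e := chartAt R4 x with he
  have hxs : x ∈ e.source := mem_chart_source R4 x
  have h1 : ∀ᶠ z in 𝓝 (e x), z ∈ e.target ∧ e.symm z ∈ W := by
    refine Filter.Eventually.and (e.open_target.mem_nhds (e.map_source hxs)) ?_
    refine (e.continuousAt_symm (e.map_source hxs)).eventually ?_
    rw [e.left_inv hxs]
    exact hW.mem_nhds hx
  obtain ⟨r, hr, hball⟩ := Metric.nhds_basis_closedBall.eventually_iff.1 h1
  set b : ContDiffBump (e x) := ⟨r / 2, r, by positivity, by linarith⟩ with hbdef
  have hbs : ContDiff ℝ ∞ b := b.contDiff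
  obtain ⟨K, hK⟩ := (hbs.of_le (show (1 : WithTop ℕ∞) ≤ ∞ by simp)).lipschitzWith_of_hasCompactSupport
    b.hasCompactSupport one_ne_zero
  have hb0 : ∀ z, z ∉ Metric.closedBall (e x) r → b z = 0 := fun z hz =>
    b.zero_of_le_dist (le_of_lt (not_le.1 hz))
  have hpush : ∀ v : R4, K * ‖v‖ < 1 → _ := fun v hv =>
    isPush_chart x (fun z hz => (hball hz).1) (fun z hz => (hball hz).2) hbs hK hb0 hv
  have h2 : ∀ᶠ y in 𝓝 x, e y ∈ Metric.ball (e x) (r / 2) :=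
    (e.continuousAt hxs).eventually (Metric.ball_mem_nhds _ (by positivity))
  have h3 : ∀ᶠ y in 𝓝 x, K * ‖e y - e x‖ < 1 := by
    have h4 : ContinuousAt (fun y => (K : ℝ) * ‖e y - e x‖) x :=
      continuousAt_const.mul ((e.continuousAt hxs).sub continuousAt_const).norm
    exact h4.eventually (gt_mem_nhds (by simp))
  filter_upwards [h2, h3, e.open_source.mem_nhds hxs] with y hy1 hy2 hy3
  have hb1 : b (e x) = 1 := b.one_of_mem_closedBall (by simp [hbdef]; positivity)
  have hb2 : b (e y) = 1 := b.one_of_mem_closedBall (Metric.ball_subset_closedBall hy1)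
  constructor
  · refine ⟨_, hpush (e y - e x) hy2, ?_⟩
    simp only [← he]
    rw [if_pos hxs, cutoffTranslation, hb1, one_smul, add_sub_cancel, e.left_inv hy3]
  · refine ⟨_, hpush (e x - e y) (by rwa [norm_sub_rev]), ?_⟩
    simp only [← he]
    rw [if_pos hy3, cutoffTranslation, hb2, one_smul, add_sub_cancel, e.left_inv hxs]

/-- Otherwise the set of points that can be pushed to `p` lies in `R ⊆ W`. Small pushes make it open
and, as `R` is closed, also closed; by connectedness it is all of `M`, against `R ≠ univ`. -/
theorem exists_isPush_preimage_notMem [ConnectedSpace M] {R W : Set M} (hR : IsClosed R)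
    (hRne : R ≠ univ) (hW : IsOpen W) (hRW : R ⊆ W) (p : M) :
    ∃ g q, IsPush W g ∧ g q = p ∧ q ∉ R := by
  by_contra! hcon
  set S : Set M := {q | ∃ g, IsPush W g ∧ g q = p} with hS
  have hSR : S ⊆ R := by
    rintro q ⟨g, hg, hgq⟩
    exact hcon g q hg hgq
  have hopen : IsOpen S := by
    rw [isOpen_iff_mem_nhds]
    rintro q hq
    obtain ⟨g, hg, hgq⟩ := hq
    filter_upwards [eventually_exists_isPush hW (hRW (hSR ⟨g, hg, hgq⟩))] with y hy
    obtain ⟨-, k, hk, hky⟩ := hy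
    exact ⟨g ∘ k, hg.comp hk, by rw [Function.comp_apply, hky, hgq]⟩
  have hclosed : IsClosed S := by
    rw [isClosed_iff_clusterPt]
    intro q hq
    have hqR : q ∈ R := hR.closure_subset_iff.2 hSR (mem_closure_iff_clusterPt.2 hq)
    have h1 := eventually_exists_isPush hW (hRW hqR)
    obtain ⟨y, hyS, ⟨k, hk, hky⟩, -⟩ :=
      ((mem_closure_iff_frequently.1 (mem_closure_iff_clusterPt.2 hq)).and_eventually h1).exists
    obtain ⟨g, hg, hgy⟩ := hyS
    exact ⟨g ∘ k, hg.comp hk, by rw [Function.comp_apply, hky, hgy]⟩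
  have huniv : S = univ := IsClopen.eq_univ ⟨hclosed, hopen⟩ ⟨p, id, IsPush.id W, rfl⟩
  exact hRne (univ_subset_iff.1 (huniv ▸ hSR))

/-- The points are avoided one at a time. Each new push is supported away from the preimages of the
points already treated, so it brings none of them back. -/
theorem exists_isPush_preimage_disjoint [ConnectedSpace M] {R W : Set M} (hR : IsClosed R)
    (hRne : R ≠ univ) (hW : IsOpen W) (hRW : R ⊆ W) {F : Set M} (hF : F.Finite) :
    ∃ g, IsPush W g ∧ ∀ x ∈ R, g x ∉ F := by
  induction F, hF using Set.Finite.induction_on with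
  | empty => exact ⟨id, IsPush.id W, fun _ _ h => h⟩
  | @insert p F _ hF ih =>
    obtain ⟨g, hg, hgF⟩ := ih
    by_cases hp : ∃ q ∈ R, g q = p
    · obtain ⟨q, -, hgq⟩ := hp
      have hfin : (g ⁻¹' F).Finite := hF.preimage hg.injective.injOn
      obtain ⟨k, q', hk, hkq, hq'⟩ := exists_isPush_preimage_notMem hR hRne
        (hW.sdiff hfin.isClosed) (fun x hx => ⟨hRW hx, hgF x hx⟩) q
      refine ⟨g ∘ k, hg.comp (hk.mono sdiff_subset), fun x hx => ?_⟩
      rintro (h | h)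
      · have h1 : k x = k q' := by rw [hkq]; exact hg.injective (h.trans hgq.symm)
        exact hq' (hk.injective h1 ▸ hx)
      -- Here `k x` lies over `F`, outside the support of `k`, so injectivity forces `k x = x`, and
      -- `g x` would already lie in `F`.
      · have h1 : k (k x) = k x := hk.eq_self _ fun h' => h'.2 h
        rw [Function.comp_apply, hk.injective h1] at h
        exact hgF x hx h
    · refine ⟨g, hg, fun x hx => ?_⟩
      rintro (h | h)
      · exact hp ⟨x, hx, h⟩
      · exact hgF x hx h

end Push

/-! ### From a nondegenerate map to `S⁴` to an immersion in `ℝ⁴` -/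

section Immersion

variable {M : Type*} [TopologicalSpace M] [ChartedSpace R4 M]

theorem injective_mfderiv_chart_comp (q : S4) {u : M → S4} {x : M}
    (hu : ContMDiffAt (𝓡 4) (𝓡 4) ∞ u x) (hx : u x ∈ (chartAt R4 q).source)
    (hi : Function.Injective (mfderiv (𝓡 4) (𝓡 4) u x)) :
    ContMDiffAt (𝓡 4) (𝓡 4) ∞ (chartAt R4 q ∘ u) x ∧
      Function.Injective (mfderiv (𝓡 4) (𝓡 4) (chartAt R4 q ∘ u) x) := by
  have h1 : ContMDiffAt (𝓡 4) (𝓡 4) ∞ (chartAt R4 q) (u x) :=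
    contMDiffAt_of_mem_maximalAtlas (IsManifold.chart_mem_maximalAtlas q) hx
  refine ⟨h1.comp x hu, ?_⟩
  rw [mfderiv_comp (I' := 𝓡 4) x (h1.mdifferentiableAt (by simp)) (hu.mdifferentiableAt (by simp))]
  exact ((mdifferentiable_chart (I := 𝓡 4) q).mfderiv_injective hx).comp hi

variable [IsManifold (𝓡 4) ∞ M]

theorem eventually_injective_of_injective_mfderiv {u : M → S4} (hu : ContMDiff (𝓡 4) (𝓡 4) ∞ u)
    {N : Set M} (hN : IsOpen N) (hi : ∀ x ∈ N, Function.Injective (mfderiv (𝓡 4) (𝓡 4) u x))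
    {p : M} (hp : p ∈ N) : ∀ᶠ x in 𝓝 p, u x = u p → x = p := by
  have hmem := fun x (hx : x ∈ N ∩ u ⁻¹' (chartAt R4 (u p)).source) =>
    injective_mfderiv_chart_comp (u p) (hu x) hx.2 (hi x hx.1)
  obtain ⟨e, -, hpe, -, heq⟩ := exists_chart_of_injective_mfderiv
    (hN.inter ((chartAt R4 (u p)).open_source.preimage hu.continuous))
    (fun x hx => (hmem x hx).1) (fun x hx => (hmem x hx).2)
    (show p ∈ N ∩ u ⁻¹' (chartAt R4 (u p)).source from ⟨hp, mem_chart_source R4 (u p)⟩)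
  filter_upwards [e.open_source.mem_nhds hpe] with x hx hxp
  refine e.injOn hx hpe ?_
  rw [← heq hx, ← heq hpe, Function.comp_apply, Function.comp_apply, hxp]

/-- After the push, `u ∘ g` is still a local diffeomorphism near `R` and on `R` avoids the centre of
a stereographic projection. The push preserves `interior K`, where `u` is nondegenerate. -/
theorem hasImmersedNeighborhood_of_map [T2Space M] [CompactSpace M] [ConnectedSpace M]
    (o : Orientation4 M) {R : Set M} (hR : IsClosed R) (hRne : R ≠ univ) {u : M → S4}
    (hu : ContMDiff (𝓡 4) (𝓡 4) ∞ u) (hRu : ∀ x ∈ R, pullbackVolume u x ≠ 0) :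
    HasImmersedNeighborhood R := by
  set N : Set M := (zeroLocus u)ᶜ with hN
  have hNo : IsOpen N := (isClosed_zeroLocus o hu).isOpen_compl
  have hNi : ∀ x ∈ N, Function.Injective (mfderiv (𝓡 4) (𝓡 4) u x) := fun x hx =>
    injective_mfderiv_of_pullbackVolume_ne_zero hx
  obtain ⟨K, hK, hRK, hKN⟩ := exists_compact_between hR.isCompact hNo hRu
  -- Any point of the sphere would serve as the centre of projection.
  set pt : S4 := centralProj 0 with hpt
  have hfin : {x ∈ K | u x = pt}.Finite := by
    refine finite_of_forall_eventually_eq hK fun p hp => ?_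
    by_cases h : u p = pt
    · rw [← h]
      exact eventually_injective_of_injective_mfderiv hu hNo hNi (hKN hp)
    · filter_upwards [hu.continuous.continuousAt.eventually_ne h] with x hx hx' using
        absurd hx' hx
  obtain ⟨g, hg, hgR⟩ := exists_isPush_preimage_disjoint hR hRne isOpen_interior hRK hfin
  have hug : ContMDiff (𝓡 4) (𝓡 4) ∞ (u ∘ g) := hu.comp hg.contMDiff
  -- The preferred chart at a point projects from its antipode, so the chart at `-pt` is defined
  -- exactly off `pt`.
  have hsource : (chartAt R4 (-pt)).source = {pt}ᶜ := by
    change (stereographic' 4 (- -pt)).source = _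
    rw [stereographic'_source, neg_neg]
  set V : TopologicalSpace.Opens M := ⟨interior K ∩ (u ∘ g) ⁻¹' {pt}ᶜ,
    isOpen_interior.inter (isOpen_compl_singleton.preimage hug.continuous)⟩ with hV
  refine ⟨V, fun x hx => ⟨hRK hx, fun h => hgR x hx
    ⟨interior_subset (hg.mem (hRK hx)), h⟩⟩, fun x => chartAt R4 (-pt) (u (g x)), ?_⟩
  have hval : ContMDiff (𝓡 4) (𝓡 4) ∞ (Subtype.val : V → M) := contMDiff_subtype_val
  have key : ∀ x : V, ContMDiffAt (𝓡 4) (𝓡 4) ∞ (chartAt R4 (-pt) ∘ ((u ∘ g) ∘ Subtype.val)) x ∧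
      Function.Injective
        (mfderiv (𝓡 4) (𝓡 4) (chartAt R4 (-pt) ∘ ((u ∘ g) ∘ (Subtype.val : V → M))) x) := by
    intro x
    refine injective_mfderiv_chart_comp (-pt) ((hug.comp hval) x) ?_ ?_
    · rw [hsource]
      exact x.2.2
    · rw [mfderiv_comp (I' := 𝓡 4) x (hug.mdifferentiableAt (by simp))
        (hval.mdifferentiableAt (by simp)), mfderiv_comp (I' := 𝓡 4) (x : M)
        (hu.mdifferentiableAt (by simp)) (hg.contMDiff.mdifferentiableAt (by simp))]
      exact ((hNi _ (hKN (interior_subset (hg.mem x.2.1)))).comp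
        (hg.injective_mfderiv _)).comp (injective_mfderiv_of_isImmersionAt
          (Manifold.IsImmersionAt.of_opens V x.2))
  exact isImmersion_of_injective_mfderiv (fun x => (key x).1) fun x => (key x).2

end Immersion

end

theorem mainTheorem9 {M : Type*} [TopologicalSpace M] [T2Space M] [CompactSpace M]
    [ConnectedSpace M] [ChartedSpace R4 M] [IsManifold (𝓡 4) ∞ M] (o : Orientation4 M)
    (φ : M → S4) (hφ : ContMDiff (𝓡 4) (𝓡 4) ∞ φ)
    (hnonneg : ∀ x : M, o.Nonneg (pullbackVolume φ x))
    (hnonzero : ∃ x : M, pullbackVolume φ x ≠ 0) :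
    ((∃ φ' : M → S4, ContMDiff (𝓡 4) (𝓡 4) ∞ φ' ∧
        ∀ x : M, pullbackVolume φ x + pullbackVolume φ' x ≠ 0) ↔
      HasImmersedNeighborhood (zeroLocus φ)) ∧
    (HasImmersedNeighborhood (zeroLocus φ) →
      ∃ φ' : M → S4, ContMDiff (𝓡 4) (𝓡 4) ∞ φ' ∧
        (∀ x : M, pullbackVolume φ x + pullbackVolume φ' x ≠ 0) ∧ o.HasDegree φ' 0) := by
  refine ⟨⟨?_, fun h => ?_⟩, exists_complementary_map o hφ hnonneg hnonzero⟩
  · rintro ⟨φ', hφ', hsum⟩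
    refine hasImmersedNeighborhood_of_map o (isClosed_zeroLocus o hφ) ?_ hφ' fun x hx h => ?_
    · obtain ⟨x, hx⟩ := hnonzero
      exact fun h => hx (h ▸ mem_univ x : x ∈ zeroLocus φ)
    · exact hsum x (by rw [show pullbackVolume φ x = 0 from hx, h, add_zero])
  · obtain ⟨φ', h1, h2, -⟩ := exists_complementary_map o hφ hnonneg hnonzero h
    exact ⟨φ', h1, h2⟩
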